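/- Let $\ell_\infty^d=(\mathbb{R}^d,\|\cdot\|_\infty)$, with standard basis $b_1,\dots,b_d$. All graphs are finite and simple. For a real symmetric matrix $A$, let $\lambda_1(A)\le\lambda_2(A)\le\cdots$ be its eigenvalues, repeated according to multiplicity. For a graph $H$ with Laplacian matrix $L(H)$, let $a(H)=\lambda_2(L(H))$. Let $X=(\mathbb{R}^d,\|\cdot\|_X)$ be a normed space. A support functional for a point $x_0$ with $\|x_0\|_X=1$ is a linear functional $\varphi$ with $\varphi(x_0)=1$ and dual norm $1$; the norm is smooth at $x_0$ if exactly one such $\varphi$ exists. For a graph $G=(V,E)$, let $\mathcal{W}(G,X)$ be the set of all $p=(p_v)_{v\in V}\in(\mathbb{R}^d)^V$ such that, for each edge $vw\in E$, $p_v\ne p_w$ and the norm is smooth at $\frac{p_v-p_w}{\|p_v-p_w\|_X}$; let $\varphi_{v,w}$ be the support functional for this point. For $p\in\mathcal{W}(G,X)$ the rigidity matrix $R(G,p)$ is the $E\times(V\times[d])$ matrix whose $(e,(v,i))$-entry is $\varphi_{v,w}(b_i)$ if $e=vw$, and $0$ if $v\notin e$. Put $L(G,p)=R(G,p)^{\top}R(G,p)$.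 A rigid motion of $X$ is a family of continuous paths $\alpha_x:(-1,1)\to\mathbb{R}^d$ ($x\in\mathbb{R}^d$), each differentiable at $0$, with $\alpha_x(0)=x$ and $\|\alpha_x(t)-\alpha_y(t)\|_X=\|x-y\|_X$ for all $x,y\in\mathbb{R}^d$ and $t\in(-1,1)$. Let $k(X)$ be the dimension of the space of maps $x\mapsto\alpha_x'(0)$ arising from rigid motions. The algebraic connectivity of $G$ in $X$ is $$a(G,X)=\sup\{\lambda_{k(X)+1}(L(G,p)) : p\in\mathcal{W}(G,X)\}.$$ For $i\in[d]$, let $\operatorname{cone}(\pm F_i)$ be the conical hull of the facet $\pm F_i$ of the unit ball of $\ell_\infty^d$, where $F_i=\{x:\|x\|_\infty\le1,\ x_i=1\}$. Each $p\in\mathcal{W}(G,\ell_\infty^d)$ induces the monochrome subgraph decomposition $(G_1,\dots,G_d)$ of $G$, where $G_i$ has vertex set $V$ and its edges are the edges $vw$ of $G$ with $p_v-p_w\in\operatorname{cone}(F_i)\cup\operatorname{cone}(-F_i)$. Let $\mathcal{M}(G,\ell_\infty^d)$ be the set of all the decompositions that arise in this way. The Cartesian product of graphs is denoted $\square$. **Corollary.**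 Let $d\ge2$ and let $G=(V,E)$ be a graph with $n:=|V|\ge d+1$ vertices. Then: (i) $a(G,\ell_\infty^d)\le a(G,\ell_\infty^{d-1})$; (ii) $a(G,\ell_\infty^d)\le a(G)/d$; (iii) either $a(G,\ell_\infty^d)=0$ or $a(G,\ell_\infty^d)\ge 2(1-\cos(\pi/n))$; (iv) $a(G,\ell_\infty^2)=\max_{(G_1,G_2)\in\mathcal{M}(G,\ell_\infty^2)} a(G_1\,\square\,G_2)$, where the maximum is attained. -/

import Mathlib

namespace NormedRigidity

open Set

/-! ### Eigenvalues and Fiedler number -/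

/-- The `j`-th smallest eigenvalue `λ_j(A)`, `1 ≤ j ≤ |m|`, of a real symmetric matrix `A`, the
eigenvalues being repeated according to multiplicity (Mathlib's `eigenvalues₀` lists them in
decreasing order).  Indices out of range are sent to `0`. -/
noncomputable def eigAsc {m : Type*} [Fintype m] [DecidableEq m] {A : Matrix m m ℝ}
    (hA : A.IsHermitian) (j : ℕ) : ℝ :=
  if h : 1 ≤ j ∧ j ≤ Fintype.card m then
    hA.eigenvalues₀ ⟨Fintype.card m - j, by omega⟩
  else 0

open Classical in
/-- The algebraic connectivity (Fiedler number) `a(G) = λ₂(L(G))` of a finite simple graph. -/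
noncomputable def algConn {V : Type*} [Fintype V] (G : SimpleGraph V) : ℝ :=
  eigAsc (G.isHermitian_lapMatrix ℝ) 2

/-! ### Normed spaces: support functionals and rigid motions -/

section NormedSpace

/-- `φ` is a support functional for the point `x₀` of the unit sphere: it has dual norm one and
takes the value one at `x₀`. -/
def IsSupportFunctional {X : Type*} [NormedAddCommGroup X] [NormedSpace ℝ X]
    (x₀ : X) (φ : StrongDual ℝ X) : Prop :=
  φ x₀ = 1 ∧ ‖φ‖ = 1

/-- The norm of `X` is smooth at the point `x₀` of the unit sphere. -/
def IsSmoothPoint {X : Type*} [NormedAddCommGroup X] [NormedSpace ℝ X] (x₀ : X) : Prop :=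
  ‖x₀‖ = 1 ∧ ∃! φ : StrongDual ℝ X, IsSupportFunctional x₀ φ

open Classical in
/-- The unique support functional for a smooth point `x₀` (and `0` if `x₀` is not smooth). -/
noncomputable def supportFunctional {X : Type*} [NormedAddCommGroup X] [NormedSpace ℝ X]
    (x₀ : X) : StrongDual ℝ X :=
  if h : IsSmoothPoint x₀ then h.2.choose else 0

/-- A rigid motion of `X`: a family of continuous paths `α x : (-1, 1) → X` starting at `x`,
differentiable at `0`, along which all distances are preserved.  The values of `α x` outside
`(-1, 1)` play no role. -/
structure IsRigidMotion {X : Type*} [NormedAddCommGroup X] [NormedSpace ℝ X]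
    (α : X → ℝ → X) : Prop where
  continuousOn : ∀ x, ContinuousOn (α x) (Ioo (-1) 1)
  map_zero : ∀ x, α x 0 = x
  differentiableAt : ∀ x, DifferentiableAt ℝ (α x) 0
  norm_sub : ∀ t ∈ Ioo (-1 : ℝ) 1, ∀ x y, ‖α x t - α y t‖ = ‖x - y‖

/-- The set `𝒯(X)` of infinitesimal rigid motions `η(x) = α_x'(0)` of `X`. -/
def infinitesimalRigidMotions (X : Type*) [NormedAddCommGroup X] [NormedSpace ℝ X] :
    Set (X → X) :=
  {η | ∃ α : X → ℝ → X, IsRigidMotion α ∧ ∀ x, η x = deriv (α x) 0}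

/-- The dimension `k(X)` of the space of infinitesimal rigid motions of `X`
(`Set.finrank` is the dimension of the linear span). -/
noncomputable def rigidMotionDim (X : Type*) [NormedAddCommGroup X] [NormedSpace ℝ X] : ℕ :=
  (infinitesimalRigidMotions X).finrank ℝ

end NormedSpace

/-! ### Frameworks and the algebraic connectivity of a graph in a normed space

The space `X` comes with a basis `b`, which for `X = (ℝ^d, ‖·‖)` is the standard one. -/

section Framework

/-- The set `𝒲(G, X)` of all `p ∈ X^V` such that `(G, p)` is a framework in `X`. -/
def frameworks {V : Type*} (G : SimpleGraph V) (X : Type*) [NormedAddCommGroup X]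
    [NormedSpace ℝ X] : Set (V → X) :=
  {p | ∀ v w, G.Adj v w → p v ≠ p w ∧ IsSmoothPoint (‖p v - p w‖⁻¹ • (p v - p w))}

open Classical in
/-- The rigidity matrix `R(G, p)`: its rows are indexed by the edges of `G`, its columns by
`V × [d]`, and the entry at `(vw, (v, i))` is `φ_{v,w}(b_i)`, where `φ_{v,w}` is the support
functional for the normalised vector `p_v - p_w`. -/
noncomputable def rigidityMatrix {V : Type*} (G : SimpleGraph V) {ι X : Type*}
    [NormedAddCommGroup X] [NormedSpace ℝ X] (b : Module.Basis ι ℝ X) (p : V → X) :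
    Matrix G.edgeSet (V × ι) ℝ :=
  fun e c ↦
    if h : c.1 ∈ (e : Sym2 V) then
      supportFunctional
        (‖p c.1 - p (Sym2.Mem.other h)‖⁻¹ • (p c.1 - p (Sym2.Mem.other h))) (b c.2)
    else 0

open Classical in
/-- The framework Laplacian matrix `L(G, p) = R(G, p)ᵀ R(G, p)`. -/
noncomputable def frameworkLaplacian {V : Type*} [Fintype V] (G : SimpleGraph V) {ι X : Type*}
    [NormedAddCommGroup X] [NormedSpace ℝ X] (b : Module.Basis ι ℝ X) (p : V → X) :
    Matrix (V × ι) (V × ι) ℝ :=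
  (rigidityMatrix G b p).transpose * rigidityMatrix G b p

theorem frameworkLaplacian_isHermitian {V : Type*} [Fintype V] (G : SimpleGraph V)
    {ι X : Type*} [NormedAddCommGroup X] [NormedSpace ℝ X] (b : Module.Basis ι ℝ X)
    (p : V → X) : (frameworkLaplacian G b p).IsHermitian := by
  classical
  rw [Matrix.IsHermitian, Matrix.conjTranspose_eq_transpose_of_trivial, frameworkLaplacian,
    Matrix.transpose_mul, Matrix.transpose_transpose]

open Classical in
/-- The rigidity eigenvalue `λ_{k(X)+1}(L(G, p))`. -/
noncomputable def rigidityEigenvalue {V : Type*} [Fintype V] (G : SimpleGraph V) {ι X : Type*}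
    [Fintype ι] [NormedAddCommGroup X] [NormedSpace ℝ X] (b : Module.Basis ι ℝ X)
    (p : V → X) : ℝ :=
  eigAsc (frameworkLaplacian_isHermitian G b p) (rigidMotionDim X + 1)

/-- The algebraic connectivity of `G` in `X`,
`a(G, X) = sup {λ_{k(X)+1}(L(G, p)) : p ∈ 𝒲(G, X)}`. -/
noncomputable def algConnIn {V : Type*} [Fintype V] (G : SimpleGraph V) {ι X : Type*}
    [Fintype ι] [NormedAddCommGroup X] [NormedSpace ℝ X] (b : Module.Basis ι ℝ X) : ℝ :=
  sSup (rigidityEigenvalue G b '' frameworks G X)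

end Framework

/-! ### The space `ℓ_∞^d`

Mathlib's norm on `Fin d → ℝ` is the maximum norm, so this normed space is `ℓ_∞^d`. -/

section LInfty

/-- The algebraic connectivity `a(G, ℓ_∞^d)`. -/
noncomputable def algConnLInfty {V : Type*} [Fintype V] (G : SimpleGraph V) (d : ℕ) : ℝ :=
  algConnIn G (Pi.basisFun ℝ (Fin d))

/-- The facet `F_i = {x : ‖x‖ ≤ 1, x_i = 1}` of the unit ball of `ℓ_∞^d`; the facets are
`F_i` and `-F_i` for `i ∈ [d]`. -/
def facet {d : ℕ} (i : Fin d) : Set (Fin d → ℝ) :=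
  {x | ‖x‖ ≤ 1 ∧ x i = 1}

/-- The conical hull of the facet `F_i`.  As `F_i` is convex and non-empty, it consists of the
non-negative multiples of the points of `F_i`. -/
def facetCone {d : ℕ} (i : Fin d) : Set (Fin d → ℝ) :=
  {y | ∃ c : ℝ, 0 ≤ c ∧ ∃ x ∈ facet i, y = c • x}

/-- The monochrome subgraph `G_i` induced by `p`: its edges are the edges `vw` of `G` with
`p_v - p_w` in `cone(F_i) ∪ cone(-F_i)`, where `cone(-F_i) = -cone(F_i)`. -/
def monochrome {V : Type*} (G : SimpleGraph V) {d : ℕ} (p : V → Fin d → ℝ) (i : Fin d) :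
    SimpleGraph V where
  Adj v w := G.Adj v w ∧ (p v - p w ∈ facetCone i ∨ -(p v - p w) ∈ facetCone i)
  symm := ⟨fun v w h ↦ by
    refine ⟨h.1.symm, ?_⟩
    rw [neg_sub, ← neg_sub (p v) (p w)]
    exact h.2.symm⟩
  loopless := ⟨fun v h ↦ G.loopless.irrefl v h.1⟩

/-- The set `ℳ(G, ℓ_∞^d)` of all monochrome subgraph decompositions `(G_1, …, G_d)` of `G`. -/
def monochromeDecompositions {V : Type*} (G : SimpleGraph V) (d : ℕ) :
    Set (Fin d → SimpleGraph V) :=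
  {H | ∃ p ∈ frameworks G (Fin d → ℝ), H = monochrome G p}

end LInfty

end NormedRigidity

/-! A unit vector of `ℓ_∞^d` is a smooth point exactly when one coordinate strictly dominates the
others in modulus, and the support functional is then that signed coordinate. Each row of the
rigidity matrix therefore sees only the coordinate that colours its edge, and the quadratic form of
the framework Laplacian splits as the sum of the Dirichlet forms of the monochrome subgraphs, one
per coordinate (`dotProduct_frameworkLaplacian_mulVec`).

The infinitesimal rigid motions are the translations, so `k(X) = d`, and they supply one constant
vector in the kernel of each block. The next eigenvalue is thus the minimum of the Fiedler numbers
of the monochrome subgraphs (`rigidityEigenvalue_eq`). A finite graph has finitely many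
decompositions, so the supremum is a maximum (`isGreatest_algConnLInfty`).

The four claims become statements about Fiedler numbers. (i) Forgetting a coordinate and perturbing
to a framework only adds edges to the remaining colour classes (`exists_monochrome_castSucc_le`).
(ii) The Fiedler number is superadditive on edge-disjoint subgraphs (`sum_algConn_le`). (iii) A
positive Fiedler number is at least that of a path (`le_algConn_of_pos`), which rests on a discrete
Wirtinger inequality. (iv) The Fiedler number of a Cartesian product is the minimum over the factors
(`algConn_boxProd`). -/

namespace NormedRigidity

open Matrix

/-! ### Eigenvalues and the Courant–Fischer principle -/

/-- Spectral coordinates of a real symmetric matrix, listed by decreasing eigenvalue. -/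
theorem exists_spectral_coordinates {m : Type*} [Fintype m] [DecidableEq m] {A : Matrix m m ℝ}
    (hA : A.IsHermitian) :
    ∃ e : Fin (Fintype.card m) → m → ℝ, (∀ x, x ⬝ᵥ x = ∑ j, (e j ⬝ᵥ x) ^ 2) ∧
      ∀ x, x ⬝ᵥ A *ᵥ x = ∑ j, hA.eigenvalues₀ j * (e j ⬝ᵥ x) ^ 2 := by
  let σ : Fin (Fintype.card m) ≃ m := Fintype.equivOfCardEq (Fintype.card_fin _)
  have hin : ∀ (i : m) (x : m → ℝ),
      inner ℝ (hA.eigenvectorBasis i) (WithLp.toLp 2 x) = ⇑(hA.eigenvectorBasis i) ⬝ᵥ x := by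
    intro i x
    rw [EuclideanSpace.inner_eq_star_dotProduct, star_trivial, dotProduct_comm]
  have key : ∀ x y : m → ℝ, x ⬝ᵥ y =
      ∑ i, (⇑(hA.eigenvectorBasis i) ⬝ᵥ x) * (⇑(hA.eigenvectorBasis i) ⬝ᵥ y) := by
    intro x y
    have h := hA.eigenvectorBasis.sum_inner_mul_inner (WithLp.toLp 2 x) (WithLp.toLp 2 y)
    rw [EuclideanSpace.inner_eq_star_dotProduct, star_trivial, dotProduct_comm] at h
    rw [← show (WithLp.toLp 2 x).ofLp ⬝ᵥ (WithLp.toLp 2 y).ofLp = x ⬝ᵥ y from rfl, ← h]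
    refine Finset.sum_congr rfl fun i _ ↦ ?_
    rw [hin, real_inner_comm, hin]
  refine ⟨fun j ↦ ⇑(hA.eigenvectorBasis (σ j)), fun x ↦ ?_, fun x ↦ ?_⟩
  · rw [key, ← σ.sum_comp]
    exact Finset.sum_congr rfl fun i _ ↦ (sq _).symm
  · rw [key, ← σ.sum_comp]
    refine Finset.sum_congr rfl fun j _ ↦ ?_
    have h1 : ⇑(hA.eigenvectorBasis (σ j)) ⬝ᵥ A *ᵥ x =
        hA.eigenvalues (σ j) * (⇑(hA.eigenvectorBasis (σ j)) ⬝ᵥ x) := by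
      rw [dotProduct_mulVec, ← mulVec_transpose,
        ← conjTranspose_eq_transpose_of_trivial, hA.eq, hA.mulVec_eigenvectorBasis,
        smul_dotProduct, smul_eq_mul]
    have h2 : hA.eigenvalues (σ j) = hA.eigenvalues₀ j := by
      simp [IsHermitian.eigenvalues, σ]
    rw [h1, h2]
    ring

/-- Variational description of the first eigenvalue beyond a known subspace of the kernel of a
positive semidefinite matrix. -/
theorem le_eigAsc_iff {m : Type*} [Fintype m] [DecidableEq m] {A : Matrix m m ℝ}
    (hA : A.IsHermitian) (hpos : ∀ x, 0 ≤ x ⬝ᵥ A *ᵥ x) (U : Submodule ℝ (m → ℝ))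
    (hU : ∀ u ∈ U, A *ᵥ u = 0) {k : ℕ} (hUk : Module.finrank ℝ U = k)
    (hk : k < Fintype.card m) (c : ℝ) :
    c ≤ eigAsc hA (k + 1) ↔
      ∀ x, (∀ u ∈ U, u ⬝ᵥ x = 0) → c * (x ⬝ᵥ x) ≤ x ⬝ᵥ A *ᵥ x := by
  obtain ⟨e, he, heA⟩ := exists_spectral_coordinates hA
  have hsymm : ∀ x y, x ⬝ᵥ A *ᵥ y = y ⬝ᵥ A *ᵥ x := by
    intro x y
    rw [dotProduct_mulVec, ← mulVec_transpose, ← conjTranspose_eq_transpose_of_trivial, hA.eq,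
      dotProduct_comm]
  have hself : ∀ x : m → ℝ, 0 ≤ x ⬝ᵥ x := fun x ↦ by
    simpa using dotProduct_star_self_nonneg x
  let p : Fin (Fintype.card m) := ⟨Fintype.card m - (k + 1), by omega⟩
  have hval : eigAsc hA (k + 1) = hA.eigenvalues₀ p := by
    rw [eigAsc, dif_pos ⟨by omega, by omega⟩]
  rw [hval]
  set l := hA.eigenvalues₀ p with hl
  constructor
  · intro hc x hx
    rcases le_or_gt c 0 with h0 | h0
    · exact (mul_nonpos_of_nonpos_of_nonneg h0 (hself x)).trans (hpos x)
    have hl0 : 0 < l := h0.trans_le hc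
    -- The `k` conditions kill the coordinates of `u + t • x` along the eigenvectors of the `k`
    -- smallest eigenvalues, which come last in the decreasing order. The domain has dimension `k +
    -- 1`, so a non-zero pair survives. Working with pairs avoids assuming `x ≠ 0`.
    let f : (U × ℝ) →ₗ[ℝ] (Fin k → ℝ) :=
      LinearMap.pi fun i ↦
        (dotProductBilin ℝ ℝ (e ⟨Fintype.card m - k + i, by omega⟩)).comp
          (U.subtype.coprod (LinearMap.toSpanSingleton ℝ (m → ℝ) x))
    obtain ⟨⟨u, t⟩, hker, hne⟩ : ∃ y ∈ LinearMap.ker f, y ≠ 0 := by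
      refine (Submodule.ne_bot_iff _).1 (LinearMap.ker_ne_bot_of_finrank_lt ?_)
      rw [Module.finrank_prod, hUk, Module.finrank_self, Module.finrank_fin_fun]
      omega
    set y : m → ℝ := u + t • x with hy
    have hcoord : ∀ j : Fin (Fintype.card m), p < j → e j ⬝ᵥ y = 0 := by
      intro j hj
      have hj' : Fintype.card m - (k + 1) < j := hj
      have := congrFun (LinearMap.mem_ker.1 hker) ⟨j - (Fintype.card m - k), by omega⟩
      simp only [f, LinearMap.pi_apply, LinearMap.comp_apply, LinearMap.coprod_apply,
        LinearMap.toSpanSingleton_apply, Submodule.subtype_apply, dotProductBilin_apply_apply,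
        Pi.zero_apply] at this
      rwa [show (⟨Fintype.card m - k + (j - (Fintype.card m - k)), _⟩ : Fin (Fintype.card m)) = j from
        Fin.ext (by simp only; omega)] at this
    have hge : l * (y ⬝ᵥ y) ≤ y ⬝ᵥ A *ᵥ y := by
      rw [he, heA, Finset.mul_sum]
      refine Finset.sum_le_sum fun j _ ↦ ?_
      rcases le_or_gt j p with hj | hj
      · exact mul_le_mul_of_nonneg_right (hA.eigenvalues₀_antitone hj) (sq_nonneg _)
      · simp [hcoord j hj]
    have hux := hx u u.2
    have hAu := hU u u.2
    have h1 : y ⬝ᵥ A *ᵥ y = t ^ 2 * (x ⬝ᵥ A *ᵥ x) := by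
      have h2 : (u : m → ℝ) ⬝ᵥ A *ᵥ x = 0 := by rw [hsymm, hAu, dotProduct_zero]
      rw [hy, mulVec_add, hAu, mulVec_smul, zero_add, add_dotProduct, dotProduct_smul,
        dotProduct_smul, smul_dotProduct, h2]
      simp only [smul_eq_mul]
      ring
    have h2 : y ⬝ᵥ y = (u : m → ℝ) ⬝ᵥ u + t ^ 2 * (x ⬝ᵥ x) := by
      rw [hy, add_dotProduct, dotProduct_add, dotProduct_add, smul_dotProduct, dotProduct_smul,
        dotProduct_smul, smul_dotProduct, dotProduct_comm x, hux]
      simp only [smul_eq_mul]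
      ring
    have hu0 := hself u
    rw [h1, h2] at hge
    -- For `t = 0` the inequality reads `l * (u ⬝ᵥ u) ≤ 0`, and `0 < l` forces the pair to vanish.
    have ht : t ≠ 0 := by
      rintro rfl
      have h3 : (u : m → ℝ) ⬝ᵥ u = 0 := by nlinarith
      have h4 : (u : m → ℝ) = 0 := dotProduct_self_eq_zero.1 h3
      exact hne (by rw [Prod.mk_eq_zero]; exact ⟨Subtype.ext h4, rfl⟩)
    have ht2 : 0 < t ^ 2 := by positivity
    refine (mul_le_mul_of_nonneg_right hc (hself x)).trans (le_of_mul_le_mul_left ?_ ht2)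
    nlinarith [mul_nonneg hl0.le hu0]
  · intro h
    -- Orthogonality to `U` and to the eigenvectors preceding index `p` amounts to `card m - 1`
    -- conditions. A non-zero solution has Rayleigh quotient at most `l`.
    let f : (m → ℝ) →ₗ[ℝ] ((Fin (Fintype.card m - (k + 1)) → ℝ) × Module.Dual ℝ U) :=
      (LinearMap.pi fun i : Fin (Fintype.card m - (k + 1)) ↦ dotProductBilin ℝ ℝ (e ⟨i, by omega⟩)).prod
        ((U.subtype.dualMap).comp (dotProductBilin ℝ ℝ))
    obtain ⟨x, hker, hne⟩ : ∃ y ∈ LinearMap.ker f, y ≠ 0 := by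
      refine (Submodule.ne_bot_iff _).1 (LinearMap.ker_ne_bot_of_finrank_lt ?_)
      rw [Module.finrank_prod, Subspace.dual_finrank_eq, hUk, Module.finrank_fin_fun,
        Module.finrank_fintype_fun_eq_card]
      omega
    have hf := LinearMap.mem_ker.1 hker
    have hcoord : ∀ j : Fin (Fintype.card m), j < p → e j ⬝ᵥ x = 0 := fun j hj ↦
      congrFun (congrArg Prod.fst hf) ⟨j, hj⟩
    have hxU : ∀ u ∈ U, u ⬝ᵥ x = 0 := by
      intro u hu
      rw [dotProduct_comm]
      exact LinearMap.congr_fun (congrArg Prod.snd hf) ⟨u, hu⟩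
    have hle : x ⬝ᵥ A *ᵥ x ≤ l * (x ⬝ᵥ x) := by
      rw [he, heA, Finset.mul_sum]
      refine Finset.sum_le_sum fun j _ ↦ ?_
      rcases le_or_gt p j with hj | hj
      · exact mul_le_mul_of_nonneg_right (hA.eigenvalues₀_antitone hj) (sq_nonneg _)
      · simp [hcoord j hj]
    have hx0 : 0 < x ⬝ᵥ x :=
      (hself x).lt_of_ne fun h0 ↦ hne (dotProduct_self_eq_zero.1 h0.symm)
    exact le_of_mul_le_mul_right ((h x hxU).trans hle) hx0

/-! ### Dirichlet forms and Fiedler numbers -/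

section DirichletForm

variable {V : Type*} [Fintype V]

open Classical in
/-- The quadratic form of the Laplacian matrix of a graph. -/
noncomputable def dirichletForm (H : SimpleGraph V) (x : V → ℝ) : ℝ :=
  (∑ v, ∑ w, if H.Adj v w then (x v - x w) ^ 2 else 0) / 2

theorem dirichletForm_nonneg (H : SimpleGraph V) (x : V → ℝ) : 0 ≤ dirichletForm H x := by
  classical
  unfold dirichletForm
  have : ∀ v w, 0 ≤ if H.Adj v w then (x v - x w) ^ 2 else 0 := fun v w ↦ by positivity
  exact div_nonneg (Finset.sum_nonneg fun v _ ↦ Finset.sum_nonneg fun w _ ↦ this v w) two_pos.le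

theorem dirichletForm_mono {H K : SimpleGraph V} (h : H ≤ K) (x : V → ℝ) :
    dirichletForm H x ≤ dirichletForm K x := by
  unfold dirichletForm
  refine div_le_div_of_nonneg_right (Finset.sum_le_sum fun v _ ↦ Finset.sum_le_sum fun w _ ↦ ?_)
    two_pos.le
  by_cases hH : H.Adj v w
  · simp [hH, h hH]
  · simp only [hH, if_false]
    positivity

theorem dirichletForm_sub_const (H : SimpleGraph V) (x : V → ℝ) (c : ℝ) :
    dirichletForm H (fun v ↦ x v - c) = dirichletForm H x := by
  simp [dirichletForm]

theorem dirichletForm_eq_zero (H : SimpleGraph V) {x : V → ℝ}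
    (h : ∀ v w, H.Adj v w → x v = x w) : dirichletForm H x = 0 := by
  classical
  have : ∀ v w, (if H.Adj v w then (x v - x w) ^ 2 else 0) = 0 := fun v w ↦ by
    split_ifs with hvw
    · simp [h v w hvw]
    · rfl
  simp [dirichletForm, this]

/-- The Fiedler number as a best constant in a Poincaré inequality. -/
theorem le_algConn_iff (hV : 2 ≤ Fintype.card V) (H : SimpleGraph V) (c : ℝ) :
    c ≤ algConn H ↔
      ∀ x : V → ℝ, ∑ v, x v = 0 → c * ∑ v, x v ^ 2 ≤ dirichletForm H x := by
  classical
  have hform : ∀ x : V → ℝ, x ⬝ᵥ H.lapMatrix ℝ *ᵥ x = dirichletForm H x := fun x ↦ by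
    rw [← toLinearMap₂'_apply', SimpleGraph.lapMatrix_toLinearMap₂']
    rfl
  have : Nonempty V := Fintype.card_pos_iff.1 (by omega)
  let U : Submodule ℝ (V → ℝ) := Submodule.span ℝ {fun _ ↦ 1}
  have hne : (fun _ : V ↦ (1 : ℝ)) ≠ 0 := fun h ↦ one_ne_zero (congrFun h (Classical.arbitrary V))
  have key := le_eigAsc_iff (H.isHermitian_lapMatrix ℝ)
    (fun x ↦ (dirichletForm_nonneg H x).trans_eq (hform x).symm) U (k := 1) (fun u hu ↦ by
      obtain ⟨t, rfl⟩ := Submodule.mem_span_singleton.1 hu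
      rw [mulVec_smul, SimpleGraph.lapMatrix_mulVec_const_eq_zero, smul_zero])
    (finrank_span_singleton hne) (by omega) c
  have halg : algConn H = eigAsc (H.isHermitian_lapMatrix ℝ) (1 + 1) := by
    unfold algConn
    congr!
  rw [halg, key]
  refine forall_congr' fun x ↦ ?_
  have h1 : (∀ u ∈ U, u ⬝ᵥ x = 0) ↔ ∑ v, x v = 0 := by
    constructor
    · intro h
      simpa [dotProduct] using h _ (Submodule.mem_span_singleton_self _)
    · intro h u hu
      obtain ⟨t, rfl⟩ := Submodule.mem_span_singleton.1 hu
      simp [dotProduct, ← Finset.mul_sum, h]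
  rw [h1, hform]
  simp [dotProduct, sq]

theorem algConn_nonneg (hV : 2 ≤ Fintype.card V) (H : SimpleGraph V) : 0 ≤ algConn H :=
  (le_algConn_iff hV H 0).2 fun x _ ↦ by simpa using dirichletForm_nonneg H x

theorem algConn_mono (hV : 2 ≤ Fintype.card V) {H K : SimpleGraph V} (h : H ≤ K) :
    algConn H ≤ algConn K :=
  (le_algConn_iff hV K _).2 fun x hx ↦
    ((le_algConn_iff hV H _).1 le_rfl x hx).trans (dirichletForm_mono h x)

/-- Superadditivity of the Fiedler number on edge-disjoint subgraphs. -/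
theorem sum_algConn_le (hV : 2 ≤ Fintype.card V) {ι : Type*} [Fintype ι] (G : SimpleGraph V)
    (H : ι → SimpleGraph V) (hle : ∀ i, H i ≤ G)
    (hdisj : ∀ i j v w, (H i).Adj v w → (H j).Adj v w → i = j) :
    ∑ i, algConn (H i) ≤ algConn G := by
  classical
  refine (le_algConn_iff hV G _).2 fun x hx ↦ ?_
  calc (∑ i, algConn (H i)) * ∑ v, x v ^ 2 = ∑ i, algConn (H i) * ∑ v, x v ^ 2 := Finset.sum_mul ..
    _ ≤ ∑ i, dirichletForm (H i) x :=
        Finset.sum_le_sum fun i _ ↦ (le_algConn_iff hV _ _).1 le_rfl x hx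
    _ ≤ dirichletForm G x := by
        unfold dirichletForm
        rw [← Finset.sum_div, Finset.sum_comm]
        refine div_le_div_of_nonneg_right (Finset.sum_le_sum fun v _ ↦ ?_) two_pos.le
        rw [Finset.sum_comm]
        refine Finset.sum_le_sum fun w _ ↦ ?_
        by_cases hex : ∃ i, (H i).Adj v w
        · obtain ⟨i, hi⟩ := hex
          rw [Finset.sum_eq_single i (fun j _ hj ↦ if_neg fun h ↦ hj (hdisj j i v w h hi))
            (fun h ↦ absurd (Finset.mem_univ i) h), if_pos hi, if_pos (hle i hi)]
        · push Not at hex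
          simp only [hex, if_false, Finset.sum_const_zero]
          positivity

/-- If no edge of `H` leaves a proper non-empty vertex set then the Fiedler number vanishes. -/
theorem exists_adj_of_algConn_pos (hV : 2 ≤ Fintype.card V) {H : SimpleGraph V}
    (hH : 0 < algConn H) (S : Set V) {a b : V} (ha : a ∈ S) (hb : b ∉ S) :
    ∃ v ∈ S, ∃ w ∉ S, H.Adj v w := by
  classical
  by_contra! hno
  -- The centred indicator of `S` has zero Dirichlet form when no edge leaves `S`, yet it is not
  -- zero.
  let y : V → ℝ := S.indicator 1
  let c : ℝ := (∑ v, y v) / Fintype.card V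
  have hcard : (Fintype.card V : ℝ) ≠ 0 := by
    have : 0 < Fintype.card V := by omega
    positivity
  have hsum : ∑ v, (y v - c) = 0 := by
    rw [Finset.sum_sub_distrib, Finset.sum_const, Finset.card_univ, nsmul_eq_mul,
      mul_div_cancel₀ _ hcard, sub_self]
  have hle := (le_algConn_iff hV H _).1 le_rfl _ hsum
  rw [dirichletForm_sub_const, dirichletForm_eq_zero] at hle
  · have h0 : ∑ v, (y v - c) ^ 2 ≤ 0 := by
      by_contra! h
      exact absurd hle (not_le.2 (mul_pos hH h))
    have h1 : ∀ v, y v - c = 0 := fun v ↦ by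
      have := (Finset.sum_eq_zero_iff_of_nonneg (fun v _ ↦ sq_nonneg (y v - c))).1
        (h0.antisymm (Finset.sum_nonneg fun v _ ↦ sq_nonneg _)) v (Finset.mem_univ v)
      exact pow_eq_zero_iff two_ne_zero |>.1 this
    have hya : y a = 1 := Set.indicator_of_mem ha _
    have hyb : y b = 0 := Set.indicator_of_notMem hb _
    have := h1 a
    have := h1 b
    linarith
  · intro v w hvw
    by_cases hv : v ∈ S <;> by_cases hw : w ∈ S
    · simp [y, hv, hw]
    · exact absurd hvw (hno v hv w hw)
    · exact absurd hvw.symm (hno w hw v hv)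
    · simp [y, hv, hw]

end DirichletForm


/-! ### Sharp discrete inequalities on a path -/

/-- The discrete Dirichlet inequality on a path. -/
theorem sum_sq_le_of_boundary_zero {n : ℕ} (hn : 2 ≤ n) (S : ℕ → ℝ) (h0 : S 0 = 0) (h1 : S n = 0) :
    2 * (1 - Real.cos (Real.pi / n)) * ∑ k ∈ Finset.range n, S k ^ 2 ≤
      ∑ k ∈ Finset.range n, (S (k + 1) - S k) ^ 2 := by
  set θ := Real.pi / n with hθ
  have hnpos : (0 : ℝ) < n := by positivity
  have hs : ∀ k : ℕ, 1 ≤ k → k < n → 0 < Real.sin (k * θ) := by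
    intro k hk hkn
    have hk' : (0 : ℝ) < k := by exact_mod_cast hk
    have hkn' : (k : ℝ) < n := by exact_mod_cast hkn
    refine Real.sin_pos_of_pos_of_lt_pi (by positivity) ?_
    rw [hθ, mul_div_assoc', div_lt_iff₀ hnpos, mul_comm]
    exact mul_lt_mul_of_pos_left hkn' Real.pi_pos
  -- Comparison with the ground state `sin (k θ)`, positive at interior points. The boundary term in
  -- `S k ^ 2` is what remains after completing squares up to `k`; each step adds the square `s * t
  -- * (a / s - b / t) ^ 2`.
  have hstep : ∀ k : ℕ, 1 ≤ k → k < n →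
      2 * (1 - Real.cos θ) * ∑ j ∈ Finset.range k, S j ^ 2 +
        (1 - Real.sin ((k - 1 : ℝ) * θ) / Real.sin (k * θ)) * S k ^ 2 ≤
      ∑ j ∈ Finset.range k, (S (j + 1) - S j) ^ 2 := by
    intro k hk
    induction k, hk using Nat.le_induction with
    | base => intro _; simp [h0]
    | succ k hk ih =>
      intro hkn
      have ih := ih (by omega)
      have hp := hs k hk (by omega)
      have hq := hs (k + 1) (by omega) hkn
      rw [Finset.sum_range_succ, Finset.sum_range_succ]
      push_cast at hq ⊢
      rw [show ((k : ℝ) + 1 - 1) * θ = k * θ by ring]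
      set a := S k
      set b := S (k + 1)
      set s := Real.sin (k * θ)
      set t := Real.sin ((k + 1) * θ)
      have hsum : Real.sin ((k - 1 : ℝ) * θ) = 2 * Real.cos θ * s - t := by
        have e1 : ((k : ℝ) - 1) * θ = k * θ - θ := by ring
        have e2 : ((k : ℝ) + 1) * θ = k * θ + θ := by ring
        simp only [s, t]
        rw [e1, e2, Real.sin_sub, Real.sin_add]
        ring
      rw [hsum] at ih
      have e : (b - a) ^ 2 - (1 - s / t) * b ^ 2 - 2 * (1 - Real.cos θ) * a ^ 2 +
          (1 - (2 * Real.cos θ * s - t) / s) * a ^ 2 = s * t * (a / s - b / t) ^ 2 := by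
        field_simp
        ring
      have : 0 ≤ s * t * (a / s - b / t) ^ 2 := by positivity
      linarith
  obtain ⟨m, rfl⟩ : ∃ m, n = m + 1 := ⟨n - 1, by omega⟩
  have hm := hstep m (by omega) (by omega)
  have hp := hs m (by omega) (by omega)
  rw [Finset.sum_range_succ, Finset.sum_range_succ, h1]
  -- The sine recurrence at the right end, where `sin ((m + 1) θ) = sin π = 0`; it makes the last
  -- boundary term match exactly.
  have hsin : Real.sin ((m - 1 : ℝ) * θ) = 2 * Real.cos θ * Real.sin (m * θ) := by
    have e1 : ((m : ℝ) - 1) * θ = m * θ - θ := by ring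
    have e2 : Real.sin (m * θ + θ) = 0 := by
      rw [show m * θ + θ = Real.pi by rw [hθ]; push_cast; field_simp, Real.sin_pi]
    rw [Real.sin_add] at e2
    rw [e1, Real.sin_sub]
    linarith
  rw [hsin, mul_div_cancel_right₀ _ hp.ne'] at hm
  linarith

/-- The discrete Wirtinger inequality on a path. -/
theorem sum_sq_le_of_sum_eq_zero {n : ℕ} (hn : 2 ≤ n) (x : ℕ → ℝ)
    (hx : ∑ k ∈ Finset.range n, x k = 0) :
    2 * (1 - Real.cos (Real.pi / n)) * ∑ k ∈ Finset.range n, x k ^ 2 ≤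
      ∑ k ∈ Finset.range (n - 1), (x (k + 1) - x k) ^ 2 := by
  set μ := 2 * (1 - Real.cos (Real.pi / n)) with hμ
  have hμ0 : 0 ≤ μ := by have := Real.cos_le_one (Real.pi / n); linarith
  -- Partial sums of a mean-zero sequence vanish at both ends, so the Dirichlet inequality applies
  -- to them and has `x` as its differences.
  let S : ℕ → ℝ := fun k ↦ ∑ j ∈ Finset.range k, x j
  have hS : ∀ k, S (k + 1) = S k + x k := fun k ↦ Finset.sum_range_succ ..
  have hD := sum_sq_le_of_boundary_zero hn S (by simp [S]) hx
  simp only [hS, add_sub_cancel_left] at hD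
  obtain ⟨m, rfl⟩ : ∃ m, n = m + 1 := ⟨n - 1, by omega⟩
  have habel : ∀ k, ∑ j ∈ Finset.range k, (x (j + 1) - x j) * S (j + 1) =
      x k * S (k + 1) - ∑ j ∈ Finset.range (k + 1), x j ^ 2 := by
    intro k
    induction k with
    | zero => simp [S, sq]
    | succ k ih =>
      rw [Finset.sum_range_succ, ih, Finset.sum_range_succ _ (k + 1), hS (k + 1)]
      ring
  have hA := habel m
  rw [show S (m + 1) = 0 from hx, mul_zero, zero_sub] at hA
  have hsh : ∑ j ∈ Finset.range m, S (j + 1) ^ 2 = ∑ k ∈ Finset.range (m + 1), S k ^ 2 := by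
    rw [Finset.sum_range_succ']
    simp [S]
  -- Duality: by Abel summation the cross term is `-2 * μ * ∑ x ^ 2`, while `hD` bounds the last
  -- term by `μ * ∑ x ^ 2`.
  have hsq : 0 ≤ ∑ j ∈ Finset.range m, ((x (j + 1) - x j) + μ * S (j + 1)) ^ 2 :=
    Finset.sum_nonneg fun _ _ ↦ sq_nonneg _
  have hexp : ∑ j ∈ Finset.range m, ((x (j + 1) - x j) + μ * S (j + 1)) ^ 2 =
      ∑ j ∈ Finset.range m, (x (j + 1) - x j) ^ 2 +
        2 * μ * ∑ j ∈ Finset.range m, (x (j + 1) - x j) * S (j + 1) +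
        μ ^ 2 * ∑ j ∈ Finset.range m, S (j + 1) ^ 2 := by
    rw [Finset.mul_sum, Finset.mul_sum, ← Finset.sum_add_distrib, ← Finset.sum_add_distrib]
    exact Finset.sum_congr rfl fun j _ ↦ by ring
  rw [hexp, hA, hsh] at hsq
  have := mul_le_mul_of_nonneg_left hD hμ0
  rw [Nat.add_sub_cancel]
  nlinarith


/-! ### Smooth points and rigid motions of the maximum norm -/

section MaxNorm

variable {ι : Type*}

/-- The `i`-th coordinate of `x` strictly dominates all the others. -/
def IsDominant (x : ι → ℝ) (i : ι) : Prop :=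
  ∀ j, j ≠ i → |x j| < |x i|

theorem IsDominant.eq {x : ι → ℝ} {i j : ι} (hi : IsDominant x i) (hj : IsDominant x j) :
    i = j := by
  by_contra h
  exact lt_asymm (hi j (Ne.symm h)) (hj i h)

theorem IsDominant.smul {x : ι → ℝ} {i : ι} (h : IsDominant x i) {c : ℝ} (hc : c ≠ 0) :
    IsDominant (c • x) i := fun j hj ↦ by
  simp only [Pi.smul_apply, smul_eq_mul, abs_mul]
  exact mul_lt_mul_of_pos_left (h j hj) (abs_pos.2 hc)

variable [Fintype ι]

theorem IsDominant.norm_eq {x : ι → ℝ} {i : ι} (h : IsDominant x i) : ‖x‖ = |x i| := by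
  refine le_antisymm ((pi_norm_le_iff_of_nonneg (abs_nonneg _)).2 fun j ↦ ?_) (norm_le_pi_norm x i)
  by_cases hj : j = i
  · rw [hj, Real.norm_eq_abs]
  · exact (h j hj).le

theorem exists_norm_eq_abs [Nonempty ι] (x : ι → ℝ) : ∃ i, ‖x‖ = |x i| := by
  obtain ⟨i, hi⟩ := Finite.exists_max fun i ↦ |x i|
  exact ⟨i, le_antisymm ((pi_norm_le_iff_of_nonneg (abs_nonneg _)).2 hi) (norm_le_pi_norm x i)⟩

theorem isDominant_of_norm_eq {x : ι → ℝ} {i : ι} (h : ‖x‖ = |x i|)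
    (huniq : ∀ j, ‖x‖ = |x j| → j = i) : IsDominant x i := fun j hj ↦
  lt_of_le_of_ne (h ▸ norm_le_pi_norm x j) fun h' ↦ hj (huniq j (h.trans h'.symm))

/-- Strict dominance of a coordinate is an open condition. -/
theorem IsDominant.eventually {x : ι → ℝ} {i : ι} (h : IsDominant x i) :
    ∀ᶠ y in nhds x, IsDominant y i := by
  refine Filter.eventually_all.2 fun j ↦ ?_
  by_cases hj : j = i
  · exact Filter.Eventually.of_forall fun y h' ↦ absurd hj h'
  · have h1 : ∀ᶠ y in nhds x, |y j| < |y i| :=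
      ((continuous_apply j).abs.tendsto x).eventually_lt ((continuous_apply i).abs.tendsto x)
        (h j hj)
    exact h1.mono fun y hy _ ↦ hy

/-- Distance-preserving motions do not change a strictly dominant coordinate of a difference
infinitesimally. -/
theorem IsRigidMotion.deriv_apply_eq_of_isDominant {α : (ι → ℝ) → ℝ → ι → ℝ}
    (hα : IsRigidMotion α) {x y : ι → ℝ} {i : ι} (h : IsDominant (x - y) i) (h0 : x i ≠ y i) :
    deriv (α x) 0 i = deriv (α y) 0 i := by
  have hmem : Set.Ioo (-1 : ℝ) 1 ∈ nhds (0 : ℝ) := Ioo_mem_nhds (by norm_num) (by norm_num)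
  have hx := (hα.differentiableAt x).hasDerivAt
  have hy := (hα.differentiableAt y).hasDerivAt
  have hxy := (hasDerivAt_pi.1 (hx.sub hy)) i
  have hcont : Filter.Tendsto (α x - α y) (nhds 0) (nhds (x - y)) := by
    have := (hx.sub hy).continuousAt.tendsto
    rwa [Pi.sub_apply, hα.map_zero, hα.map_zero] at this
  -- For small `t` the coordinate `i` still dominates, so it carries the preserved norm. Squaring
  -- removes the sign before differentiating.
  have habs : (fun t ↦ (α x - α y) t i ^ 2) =ᶠ[nhds 0] fun _ ↦ (x i - y i) ^ 2 := by
    filter_upwards [hcont.eventually h.eventually, hmem] with t ht htm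
    have h1 := hα.norm_sub t htm x y
    have h2 : ‖α x t - α y t‖ = |(α x - α y) t i| := ht.norm_eq
    rw [h2, h.norm_eq] at h1
    exact (sq_eq_sq_iff_abs_eq_abs _ _).2 h1
  have hsq := hxy.pow 2
  have huniq := hsq.unique ((hasDerivAt_const (0 : ℝ) ((x i - y i) ^ 2)).congr_of_eventuallyEq habs)
  simp only [Pi.sub_apply, hα.map_zero, Nat.cast_ofNat] at huniq
  have hne : x i - y i ≠ 0 := sub_ne_zero.2 h0
  have : deriv (α x) 0 i - deriv (α y) 0 i = 0 := by
    simpa [hne] using huniq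
  exact sub_eq_zero.1 this

theorem isDominant_add_single [DecidableEq ι] (x : ι → ℝ) (i : ι) {M : ℝ} (hM : 2 * ‖x‖ < M) :
    IsDominant (x + Pi.single i M) i := fun j hj ↦ by
  have h1 := norm_le_pi_norm x i
  have h2 := norm_le_pi_norm x j
  rw [Real.norm_eq_abs] at h1 h2
  simp only [Pi.add_apply, Pi.single_eq_same, Pi.single_eq_of_ne hj, add_zero]
  have := neg_abs_le (x i)
  exact (h2.trans_lt (by linarith)).trans_le (le_abs_self _)

/-- The infinitesimal rigid motions of `ℓ_∞` are the translations. -/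
theorem infinitesimalRigidMotions_pi :
    infinitesimalRigidMotions (ι → ℝ) =
      LinearMap.range (LinearMap.pi fun _ : ι → ℝ ↦ (LinearMap.id : (ι → ℝ) →ₗ[ℝ] ι → ℝ)) := by
  classical
  ext η
  simp only [SetLike.mem_coe, LinearMap.mem_range]
  constructor
  · rintro ⟨α, hα, hη⟩
    refine ⟨η 0, funext fun x ↦ funext fun i ↦ ?_⟩
    simp only [LinearMap.pi_apply, LinearMap.id_apply, hη]
    -- The far point `x + M e_i` differs from both `x` and `0` with dominant coordinate `i`, so the
    -- `i`-th velocities at `x` and `0` agree with the one there.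
    set M := 2 * ‖x‖ + 1 with hM
    have hx := norm_nonneg x
    have hz1 : IsDominant (x + Pi.single i M - x) i := by
      rw [add_sub_cancel_left]
      have := isDominant_add_single (0 : ι → ℝ) i (M := M) (by rw [norm_zero]; linarith)
      rwa [zero_add] at this
    have hz2 : IsDominant (x + Pi.single i M - 0) i := by
      rw [sub_zero]
      exact isDominant_add_single x i (by linarith)
    rw [← hα.deriv_apply_eq_of_isDominant hz1 (by simp; linarith),
      hα.deriv_apply_eq_of_isDominant hz2]
    have := norm_le_pi_norm x i
    rw [Real.norm_eq_abs] at this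
    have := neg_abs_le (x i)
    simp only [Pi.add_apply, Pi.single_eq_same, Pi.zero_apply]
    linarith
  · rintro ⟨u, rfl⟩
    have hd : ∀ x : ι → ℝ, HasDerivAt (fun t : ℝ ↦ x + t • u) u 0 := fun x ↦ by
      simpa using ((hasDerivAt_id (0 : ℝ)).smul_const u).const_add x
    refine ⟨fun x t ↦ x + t • u, ⟨fun x ↦ ?_, fun x ↦ ?_, fun x ↦ (hd x).differentiableAt,
      fun t _ x y ↦ ?_⟩, fun x ↦ (hd x).deriv.symm⟩
    · fun_prop
    · simp
    · simp

theorem rigidMotionDim_pi : rigidMotionDim (ι → ℝ) = Fintype.card ι := by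
  rw [rigidMotionDim, infinitesimalRigidMotions_pi, Set.finrank, Submodule.span_eq,
    LinearMap.finrank_range_of_inj, Module.finrank_fintype_fun_eq_card]
  exact fun u v h ↦ congrFun h 0

theorem norm_proj_le_one (i : ι) : ‖ContinuousLinearMap.proj (R := ℝ) (φ := fun _ : ι ↦ ℝ) i‖ ≤ 1 :=
  ContinuousLinearMap.opNorm_le_bound _ zero_le_one fun x ↦ by
    simpa using norm_le_pi_norm x i

/-- A signed coordinate of maximal modulus is a support functional. -/
theorem isSupportFunctional_smul_proj {x : ι → ℝ} (hx : ‖x‖ = 1) {i : ι} (hi : |x i| = 1) :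
    IsSupportFunctional x
      (x i • ContinuousLinearMap.proj (R := ℝ) (φ := fun _ : ι ↦ ℝ) i) := by
  have h1 : x i * x i = 1 := by rw [← abs_mul_abs_self, hi, one_mul]
  refine ⟨h1, le_antisymm ?_ ?_⟩
  · rw [norm_smul, Real.norm_eq_abs, hi, one_mul]
    exact norm_proj_le_one i
  · have := (x i • ContinuousLinearMap.proj (R := ℝ) (φ := fun _ : ι ↦ ℝ) i).le_opNorm x
    rw [hx, mul_one] at this
    refine le_trans ?_ this
    simp [h1]

/-- Moving a non-dominant coordinate `j` by `±(1 - |x j|)` stays in the unit ball. As `φ` already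
attains its maximum at `x`, it must vanish on the `j`-th basis vector. -/
theorem IsSupportFunctional.eq_smul_proj {x : ι → ℝ} (hx : ‖x‖ = 1) {i : ι}
    (hi : IsDominant x i) {φ : StrongDual ℝ (ι → ℝ)} (hφ : IsSupportFunctional x φ) :
    φ = x i • ContinuousLinearMap.proj (R := ℝ) (φ := fun _ : ι ↦ ℝ) i := by
  classical
  have hxi : |x i| = 1 := hi.norm_eq ▸ hx
  have hle : ∀ z : ι → ℝ, ‖z‖ ≤ 1 → φ z ≤ 1 := fun z hz ↦ by
    have := φ.le_opNorm z
    rw [hφ.2, one_mul] at this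
    exact (le_abs_self _).trans (this.trans hz)
  have hzero : ∀ j, j ≠ i → φ (Pi.single j 1) = 0 := by
    intro j hj
    have hpos : 0 < 1 - |x j| := by have := hi j hj; linarith
    have hnorm : ∀ s : ℝ, |s| ≤ 1 - |x j| → φ (x + s • Pi.single j 1) ≤ 1 := by
      intro s hs
      refine hle _ ((pi_norm_le_iff_of_nonneg zero_le_one).2 fun k ↦ ?_)
      rw [Real.norm_eq_abs]
      by_cases hk : k = j
      · subst hk
        simp only [Pi.add_apply, Pi.smul_apply, Pi.single_eq_same, smul_eq_mul, mul_one]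
        exact (abs_add_le _ _).trans (by linarith)
      · simp only [Pi.add_apply, Pi.smul_apply, Pi.single_eq_of_ne hk, smul_zero, add_zero]
        exact (norm_le_pi_norm x k).trans_eq hx
    have h1 := hnorm (1 - |x j|) (abs_of_pos hpos).le
    have h2 := hnorm (-(1 - |x j|)) (by rw [abs_neg, abs_of_pos hpos])
    rw [map_add, map_smul, hφ.1, smul_eq_mul] at h1 h2
    nlinarith
  have hφz : ∀ z : ι → ℝ, φ z = z i * φ (Pi.single i 1) := fun z ↦ by
    conv_lhs => rw [← Finset.univ_sum_single z]
    rw [map_sum, Finset.sum_eq_single i]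
    · rw [← mul_one (z i), ← smul_eq_mul (z i) 1, Pi.single_smul', map_smul]
      simp
    · intro j _ hj
      rw [← mul_one (z j), ← smul_eq_mul (z j) 1, Pi.single_smul', map_smul, hzero j hj, smul_zero]
    · simp
  have h1 : x i * x i = 1 := by rw [← abs_mul_abs_self, hxi, one_mul]
  have h2 : x i * φ (Pi.single i 1) = 1 := by rw [← hφz, hφ.1]
  have h3 : φ (Pi.single i 1) = x i := by
    have hne : x i ≠ 0 := by rintro h; simp [h] at h1
    exact mul_left_cancel₀ hne (h2.trans h1.symm)
  ext z
  rw [hφz, h3, mul_comm]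
  rfl

/-- Two coordinates of maximal modulus would give two distinct support functionals. -/
theorem isSmoothPoint_iff {x : ι → ℝ} : IsSmoothPoint x ↔ ‖x‖ = 1 ∧ ∃ i, IsDominant x i := by
  classical
  refine and_congr_right fun hx ↦ ⟨fun ⟨φ, _, huniq⟩ ↦ ?_, fun ⟨i, hi⟩ ↦ ?_⟩
  · have : Nonempty ι := by
      by_contra h
      rw [not_nonempty_iff] at h
      simp [Subsingleton.elim x 0] at hx
    obtain ⟨i, hi⟩ := exists_norm_eq_abs x
    refine ⟨i, isDominant_of_norm_eq hi fun j hj ↦ ?_⟩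
    have h := (huniq _ (isSupportFunctional_smul_proj hx (hi ▸ hx))).trans
      (huniq _ (isSupportFunctional_smul_proj hx (hj ▸ hx))).symm
    by_contra hne
    have h' := DFunLike.congr_fun h (Pi.single i 1)
    simp [Pi.single_eq_of_ne hne] at h'
    rw [h', abs_zero] at hi
    exact one_ne_zero (hx.symm.trans hi)
  · exact ⟨_, isSupportFunctional_smul_proj hx (hi.norm_eq ▸ hx), fun φ hφ ↦ hφ.eq_smul_proj hx hi⟩

theorem supportFunctional_eq {x : ι → ℝ} (hx : ‖x‖ = 1) {i : ι} (hi : IsDominant x i) :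
    supportFunctional x = x i • ContinuousLinearMap.proj (R := ℝ) (φ := fun _ : ι ↦ ℝ) i := by
  have hs : IsSmoothPoint x := isSmoothPoint_iff.2 ⟨hx, i, hi⟩
  rw [supportFunctional, dif_pos hs]
  exact hs.2.choose_spec.1.eq_smul_proj hx hi

theorem mem_frameworks_pi_iff {V : Type*} (G : SimpleGraph V) (p : V → ι → ℝ) :
    p ∈ frameworks G (ι → ℝ) ↔
      ∀ v w, G.Adj v w → p v ≠ p w ∧ ∃ i, IsDominant (p v - p w) i := by
  refine forall₂_congr fun v w ↦ imp_congr_right fun _ ↦ and_congr_right fun hne ↦ ?_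
  have hn : ‖p v - p w‖ ≠ 0 := norm_ne_zero_iff.2 (sub_ne_zero.2 hne)
  rw [isSmoothPoint_iff]
  constructor
  · rintro ⟨_, i, hi⟩
    have := hi.smul hn
    rw [smul_inv_smul₀ hn] at this
    exact ⟨i, this⟩
  · rintro ⟨i, hi⟩
    exact ⟨by rw [norm_smul, norm_inv, norm_norm, inv_mul_cancel₀ hn], i, hi.smul (inv_ne_zero hn)⟩

end MaxNorm

/-! ### Facet cones and monochrome subgraphs -/

theorem mem_facetCone_iff {d : ℕ} {i : Fin d} {y : Fin d → ℝ} : y ∈ facetCone i ↔ ‖y‖ = y i := by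
  constructor
  · rintro ⟨c, hc, x, ⟨hx, hxi⟩, rfl⟩
    have h1 : ‖x‖ = 1 := hx.antisymm (by simpa [hxi] using norm_le_pi_norm x i)
    simp [norm_smul, h1, hxi, abs_of_nonneg hc]
  · intro h
    rcases eq_or_ne y 0 with rfl | hy
    · refine ⟨0, le_rfl, Pi.single i 1, ⟨?_, by simp⟩, by simp⟩
      refine (pi_norm_le_iff_of_nonneg zero_le_one).2 fun j ↦ ?_
      by_cases hj : j = i
      · simp [hj]
      · simp [hj]
    · have hn : ‖y‖ ≠ 0 := norm_ne_zero_iff.2 hy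
      refine ⟨‖y‖, norm_nonneg y, ‖y‖⁻¹ • y, ⟨?_, ?_⟩, (smul_inv_smul₀ hn y).symm⟩
      · rw [norm_smul, norm_inv, norm_norm, inv_mul_cancel₀ hn]
      · rw [Pi.smul_apply, smul_eq_mul, ← h, inv_mul_cancel₀ hn]

/-- Facet cones overlap along ties between coordinates; a framework has no ties on its edges, so
each edge has exactly one colour. -/
theorem monochrome_adj_iff {V : Type*} {G : SimpleGraph V} {d : ℕ} {p : V → Fin d → ℝ}
    (hp : p ∈ frameworks G (Fin d → ℝ)) {i : Fin d} {v w : V} :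
    (monochrome G p i).Adj v w ↔ G.Adj v w ∧ IsDominant (p v - p w) i := by
  refine and_congr_right fun hvw ↦ ?_
  obtain ⟨j, hj⟩ := ((mem_frameworks_pi_iff G p).1 hp v w hvw).2
  rw [mem_facetCone_iff, mem_facetCone_iff, norm_neg, Pi.neg_apply]
  constructor
  · intro h
    have hi : ‖p v - p w‖ = |(p v - p w) i| := by
      rcases h with h | h
      · rw [h, abs_of_nonneg (h ▸ norm_nonneg _)]
      · rw [h, ← abs_neg, abs_of_nonneg (h ▸ norm_nonneg _)]
    have : i = j := by
      by_contra hij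
      exact (hj i hij).ne (hi.symm.trans hj.norm_eq)
    exact this ▸ hj
  · intro h
    rw [h.norm_eq]
    rcases abs_choice ((p v - p w) i) with h' | h'
    · exact Or.inl h'
    · exact Or.inr h'

/-! ### Block structure of the framework Laplacian -/

section Framework

variable {V : Type*}

theorem rigidityMatrix_apply_left (G : SimpleGraph V) {d : ℕ} (p : V → Fin d → ℝ) {v w : V}
    (h : s(v, w) ∈ G.edgeSet) (j : Fin d) :
    rigidityMatrix G (Pi.basisFun ℝ (Fin d)) p ⟨s(v, w), h⟩ (v, j) =
      supportFunctional (‖p v - p w‖⁻¹ • (p v - p w)) (Pi.single j 1) := by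
  have hv : v ∈ s(v, w) := Sym2.mem_mk_left v w
  have hw : Sym2.Mem.other hv = w := Sym2.congr_right.1 (Sym2.other_spec hv)
  rw [rigidityMatrix, dif_pos hv, Pi.basisFun_apply]
  simp only [hw]

variable [Fintype V]

-- Every edge arises from two ordered pairs; this brings sums over edges into the shape used by
-- `dirichletForm`.
open Classical in
theorem sum_edgeSet_eq (G : SimpleGraph V) (f : G.edgeSet → ℝ) :
    ∑ e, f e = (∑ v, ∑ w, if h : G.Adj v w then f ⟨s(v, w), h⟩ else 0) / 2 := by
  let F : Sym2 V → ℝ := fun e ↦ if h : e ∈ G.edgeSet then f ⟨e, h⟩ else 0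
  have h1 : ∑ e, f e = ∑ e ∈ G.edgeFinset, F e := by
    rw [Finset.sum_subtype G.edgeFinset (p := (· ∈ G.edgeSet))
      (fun e ↦ SimpleGraph.mem_edgeFinset) F]
    exact Finset.sum_congr rfl fun e _ ↦ (show F e = f e from dif_pos e.2).symm
  have h2 : (∑ v, ∑ w, if h : G.Adj v w then f ⟨s(v, w), h⟩ else 0) =
      ∑ x ∈ Finset.univ.filter fun x : V × V ↦ G.Adj x.1 x.2, F s(x.1, x.2) := by
    rw [Finset.sum_filter, Fintype.sum_prod_type]
    refine Finset.sum_congr rfl fun v _ ↦ Finset.sum_congr rfl fun w _ ↦ ?_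
    by_cases h : G.Adj v w
    · simp [F, h]
    · simp [h]
  have h3 : ∑ x ∈ Finset.univ.filter fun x : V × V ↦ G.Adj x.1 x.2, F s(x.1, x.2) =
      ∑ e ∈ G.edgeFinset, 2 * F e := by
    rw [← Finset.sum_fiberwise_of_maps_to (g := fun x : V × V ↦ s(x.1, x.2)) (t := G.edgeFinset)
      (fun x hx ↦ by simpa using hx)]
    refine Finset.sum_congr rfl fun e he ↦ ?_
    induction e with
    | _ a b =>
      have hab : G.Adj a b := by simpa using he
      have : ((Finset.univ.filter fun x : V × V ↦ G.Adj x.1 x.2).filter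
          fun x ↦ s(x.1, x.2) = s(a, b)) = {(a, b), (b, a)} := by
        ext ⟨v, w⟩
        simp only [Finset.mem_filter, Finset.mem_univ, true_and, Sym2.eq_iff, Finset.mem_insert,
          Finset.mem_singleton, Prod.mk.injEq]
        constructor
        · exact fun h ↦ h.2
        · rintro (⟨rfl, rfl⟩ | ⟨rfl, rfl⟩)
          · exact ⟨hab, by simp⟩
          · exact ⟨hab.symm, by simp⟩
      rw [this, Finset.sum_pair (by simp [hab.ne]), Sym2.eq_swap (a := b)]
      ring
  rw [h1, h2, h3, ← Finset.mul_sum]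
  ring

/-- Each row of the rigidity matrix measures, up to sign, the difference of the dominant
coordinates. -/
theorem rigidityMatrix_mulVec_sq (G : SimpleGraph V) {d : ℕ} {p : V → Fin d → ℝ}
    (hp : p ∈ frameworks G (Fin d → ℝ)) {v w : V} (h : G.Adj v w) {i : Fin d}
    (hi : IsDominant (p v - p w) i) (x : V × Fin d → ℝ) :
    (rigidityMatrix G (Pi.basisFun ℝ (Fin d)) p *ᵥ x) ⟨s(v, w), h⟩ ^ 2 =
      (x (v, i) - x (w, i)) ^ 2 := by
  classical
  have hn : ‖p v - p w‖ ≠ 0 :=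
    norm_ne_zero_iff.2 (sub_ne_zero.2 ((mem_frameworks_pi_iff G p).1 hp v w h).1)
  have hn' : ‖p w - p v‖ ≠ 0 := by rwa [norm_sub_rev]
  have hi' : IsDominant (p w - p v) i := by
    have := hi.smul (neg_ne_zero.2 one_ne_zero)
    rwa [neg_smul, one_smul, neg_sub] at this
  have hone : ∀ y : Fin d → ℝ, ‖y‖ ≠ 0 → ‖‖y‖⁻¹ • y‖ = 1 := fun y hy ↦ by
    rw [norm_smul, norm_inv, norm_norm, inv_mul_cancel₀ hy]
  -- The support functional is a multiple of the `i`-th coordinate, so only column `(a, i)`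
  -- contributes at the endpoint `a`.
  have hrow : ∀ a b : V, ∀ hab : s(a, b) ∈ G.edgeSet, IsDominant (p a - p b) i →
      ‖p a - p b‖ ≠ 0 →
      ∑ j, rigidityMatrix G (Pi.basisFun ℝ (Fin d)) p ⟨s(a, b), hab⟩ (a, j) * x (a, j) =
        (‖p a - p b‖⁻¹ * (p a - p b) i) * x (a, i) := by
    intro a b hab hd hne
    rw [Finset.sum_eq_single i]
    · rw [rigidityMatrix_apply_left, supportFunctional_eq (hone _ hne) (hd.smul (inv_ne_zero hne))]
      simp
    · intro j _ hj
      rw [rigidityMatrix_apply_left, supportFunctional_eq (hone _ hne) (hd.smul (inv_ne_zero hne))]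
      simp [Pi.single_eq_of_ne hj.symm]
    · simp
  have hsum : (rigidityMatrix G (Pi.basisFun ℝ (Fin d)) p *ᵥ x) ⟨s(v, w), h⟩ =
      (‖p v - p w‖⁻¹ * (p v - p w) i) * (x (v, i) - x (w, i)) := by
    rw [mulVec, dotProduct, Fintype.sum_prod_type, Finset.sum_eq_add v w h.ne]
    · rw [hrow v w h hi hn]
      have e : (⟨s(v, w), h⟩ : G.edgeSet) = ⟨s(w, v), h.symm⟩ := Subtype.ext Sym2.eq_swap
      rw [e, hrow w v h.symm hi' hn', norm_sub_rev (p w), ← neg_sub (p v), Pi.neg_apply]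
      ring
    · intro u _ hu
      refine Finset.sum_eq_zero fun j _ ↦ ?_
      have : u ∉ s(v, w) := by simpa [not_or] using hu
      rw [rigidityMatrix, dif_neg this, zero_mul]
    · simp
    · simp
  have hsq : (‖p v - p w‖⁻¹ * (p v - p w) i) ^ 2 = 1 := by
    rw [mul_pow, ← sq_abs ((p v - p w) i), ← hi.norm_eq, ← mul_pow, inv_mul_cancel₀ hn, one_pow]
  rw [hsum, mul_pow, hsq, one_mul]

/-- The framework Laplacian in `ℓ_∞^d` is the direct sum of the Laplacians of the monochrome
subgraphs. -/
theorem dotProduct_frameworkLaplacian_mulVec (G : SimpleGraph V) {d : ℕ} {p : V → Fin d → ℝ}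
    (hp : p ∈ frameworks G (Fin d → ℝ)) (x : V × Fin d → ℝ) :
    x ⬝ᵥ frameworkLaplacian G (Pi.basisFun ℝ (Fin d)) p *ᵥ x =
      ∑ i, dirichletForm (monochrome G p i) fun v ↦ x (v, i) := by
  classical
  rw [frameworkLaplacian, ← mulVec_mulVec, dotProduct_mulVec, vecMul_transpose, dotProduct]
  simp only [← sq]
  rw [sum_edgeSet_eq]
  unfold dirichletForm
  rw [← Finset.sum_div, Finset.sum_comm (s := (Finset.univ : Finset (Fin d)))]
  congr 1
  refine Finset.sum_congr rfl fun v _ ↦ ?_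
  rw [Finset.sum_comm (s := (Finset.univ : Finset (Fin d)))]
  refine Finset.sum_congr rfl fun w _ ↦ ?_
  by_cases h : G.Adj v w
  · obtain ⟨i, hi⟩ := ((mem_frameworks_pi_iff G p).1 hp v w h).2
    rw [dif_pos h, rigidityMatrix_mulVec_sq G hp h hi, Finset.sum_eq_single i]
    · rw [if_pos ((monochrome_adj_iff hp).2 ⟨h, hi⟩)]
    · intro j _ hj
      exact if_neg fun h' ↦ hj (((monochrome_adj_iff hp).1 h').2.eq hi)
    · simp
  · have h' : ∀ i, ¬ (monochrome G p i).Adj v w := fun i h' ↦ h h'.1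
    simp [h, h']

/-- The translations form a subspace of the kernel of dimension `k(X) = d`. Orthogonality to it
means mean zero in every coordinate, so the variational inequality decouples into one Poincaré
inequality per colour. -/
theorem le_rigidityEigenvalue_iff (hV : 2 ≤ Fintype.card V) (G : SimpleGraph V) {d : ℕ}
    (hd : d ≠ 0) {p : V → Fin d → ℝ} (hp : p ∈ frameworks G (Fin d → ℝ)) (c : ℝ) :
    c ≤ rigidityEigenvalue G (Pi.basisFun ℝ (Fin d)) p ↔
      ∀ i, c ≤ algConn (monochrome G p i) := by
  classical
  have hform := dotProduct_frameworkLaplacian_mulVec G hp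
  let T : (Fin d → ℝ) →ₗ[ℝ] (V × Fin d → ℝ) := LinearMap.funLeft ℝ ℝ Prod.snd
  have : Nonempty V := Fintype.card_pos_iff.1 (by omega)
  have hT : Function.Injective T :=
    LinearMap.funLeft_injective_of_surjective ℝ ℝ _ Prod.snd_surjective
  have hker : ∀ u ∈ LinearMap.range T,
      frameworkLaplacian G (Pi.basisFun ℝ (Fin d)) p *ᵥ u = 0 := by
    rintro _ ⟨t, rfl⟩
    have : rigidityMatrix G (Pi.basisFun ℝ (Fin d)) p *ᵥ T t = 0 := by
      ext ⟨e, he⟩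
      induction e with
      | _ v w =>
        obtain ⟨i, hi⟩ := ((mem_frameworks_pi_iff G p).1 hp v w he).2
        have := rigidityMatrix_mulVec_sq G hp he hi (T t)
        simpa [T] using this
    rw [frameworkLaplacian, ← mulVec_mulVec, this, mulVec_zero]
  have hrank : Module.finrank ℝ (LinearMap.range T) = rigidMotionDim (Fin d → ℝ) := by
    rw [LinearMap.finrank_range_of_inj hT, rigidMotionDim_pi, Module.finrank_fintype_fun_eq_card]
  have heig : rigidityEigenvalue G (Pi.basisFun ℝ (Fin d)) p =
      eigAsc (frameworkLaplacian_isHermitian G (Pi.basisFun ℝ (Fin d)) p)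
        (rigidMotionDim (Fin d → ℝ) + 1) := by
    unfold rigidityEigenvalue
    congr!
  rw [heig, le_eigAsc_iff _ (fun x ↦ by
    rw [hform]; exact Finset.sum_nonneg fun i _ ↦ dirichletForm_nonneg _ _) _ hker hrank (by
    rw [rigidMotionDim_pi, Fintype.card_prod, Fintype.card_fin]
    nlinarith [Nat.pos_of_ne_zero hd])]
  have hsq : ∀ x : V × Fin d → ℝ, x ⬝ᵥ x = ∑ i, ∑ v, x (v, i) ^ 2 := fun x ↦ by
    rw [dotProduct, Fintype.sum_prod_type_right]
    simp only [sq]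
  have horth : ∀ x : V × Fin d → ℝ,
      (∀ u ∈ LinearMap.range T, u ⬝ᵥ x = 0) ↔ ∀ i, ∑ v, x (v, i) = 0 := by
    intro x
    have hdot : ∀ t, T t ⬝ᵥ x = ∑ i, t i * ∑ v, x (v, i) := fun t ↦ by
      rw [dotProduct, Fintype.sum_prod_type_right]
      simp only [T, LinearMap.funLeft_apply, Finset.mul_sum]
    constructor
    · intro h i
      have := h _ ⟨Pi.single i 1, rfl⟩
      rw [hdot, Finset.sum_eq_single i (fun j _ hj ↦ by simp [Pi.single_eq_of_ne hj])
        (by simp)] at this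
      simpa using this
    · rintro h _ ⟨t, rfl⟩
      rw [hdot]
      simp [h]
  simp only [horth, hform, hsq]
  constructor
  · intro h i
    refine (le_algConn_iff hV _ _).2 fun y hy ↦ ?_
    -- The test vector lives in the single block `i`.
    have := h (fun a ↦ if a.2 = i then y a.1 else 0) fun j ↦ by
      by_cases hj : j = i <;> simp [hj, hy]
    simp only at this
    rw [Finset.sum_eq_single i, Finset.sum_eq_single i] at this
    · simpa using this
    · intro j _ hj
      exact dirichletForm_eq_zero _ fun v w _ ↦ by simp [hj]
    · simp
    · intro j _ hj
      simp [hj]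
    · simp
  · intro h x hx
    rw [Finset.mul_sum]
    exact Finset.sum_le_sum fun i _ ↦ (le_algConn_iff hV _ _).1 (h i) _ (hx i)

theorem rigidityEigenvalue_eq (hV : 2 ≤ Fintype.card V) (G : SimpleGraph V) {d : ℕ}
    (hd : d ≠ 0) {p : V → Fin d → ℝ} (hp : p ∈ frameworks G (Fin d → ℝ)) :
    rigidityEigenvalue G (Pi.basisFun ℝ (Fin d)) p = ⨅ i, algConn (monochrome G p i) := by
  have : Nonempty (Fin d) := Fin.pos_iff_nonempty.1 (Nat.pos_of_ne_zero hd)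
  refine eq_of_forall_le_iff fun c ↦ ?_
  rw [le_rigidityEigenvalue_iff hV G hd hp, le_ciInf_iff (Set.finite_range _).bddBelow]

end Framework


/-! ### Fiedler's path bound -/

/-- The sum of the squares of the consecutive differences of a monotone sequence is at most the
square of the total difference. -/
theorem sum_sq_sub_le_sq_sub {y : ℕ → ℝ} {a b : ℕ} (hab : a ≤ b)
    (hy : ∀ k, a ≤ k → k < b → y k ≤ y (k + 1)) :
    ∑ k ∈ Finset.Ico a b, (y (k + 1) - y k) ^ 2 ≤ (y b - y a) ^ 2 ∧ y a ≤ y b := by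
  induction b, hab using Nat.le_induction with
  | base => simp
  | succ b hab ih =>
    obtain ⟨h1, h2⟩ := ih fun k hk hkb ↦ hy k hk (by omega)
    have h3 := hy b hab (by omega)
    rw [Finset.sum_Ico_succ_top hab]
    exact ⟨by nlinarith, h2.trans h3⟩

section Fiedler

variable {V : Type*} [Fintype V]

/-- Fiedler's bound: a graph with positive algebraic connectivity has at least the algebraic
connectivity of the path. -/
theorem le_algConn_of_pos (hV : 2 ≤ Fintype.card V) {H : SimpleGraph V} (hH : 0 < algConn H) :
    2 * (1 - Real.cos (Real.pi / (Fintype.card V : ℝ))) ≤ algConn H := by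
  classical
  refine (le_algConn_iff hV H _).2 fun x hx ↦ ?_
  let n := Fintype.card V
  let e₀ : Fin n ≃ V := (Fintype.equivFin V).symm
  -- Vertices are listed by increasing value of `x`, to be compared with the path along this order.
  let e : Fin n ≃ V := (Tuple.sort (x ∘ e₀)).trans e₀
  have hmono : Monotone (x ∘ e) := Tuple.monotone_sort (x ∘ e₀)
  let y : ℕ → ℝ := fun k ↦ if h : k < n then x (e ⟨k, h⟩) else 0
  have hye : ∀ v, y (e.symm v) = x v := fun v ↦ by simp [y]
  have hsum : ∀ f : ℝ → ℝ, ∑ k ∈ Finset.range n, f (y k) = ∑ v, f (x v) := fun f ↦ by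
    rw [Finset.sum_range, ← e.symm.sum_comp]
    exact Finset.sum_congr rfl fun v _ ↦ by rw [hye]
  have hystep : ∀ k, k + 1 < n → y k ≤ y (k + 1) := fun k hk ↦ by
    simp only [y, dif_pos hk, dif_pos (show k < n by omega)]
    exact hmono (Fin.mk_le_mk.2 (Nat.le_succ k))
  have hW := sum_sq_le_of_sum_eq_zero hV y ((hsum id).trans hx)
  rw [hsum (· ^ 2)] at hW
  refine hW.trans ?_
  -- Each gap `k` is charged to an edge crossing the cut between positions `k` and `k + 1`, which
  -- exists since the Fiedler number is positive. An edge then pays for the gaps it spans by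
  -- `sum_sq_sub_le_sq_sub`.
  have hdir : ∑ k ∈ Finset.range (n - 1), (y (k + 1) - y k) ^ 2 ≤
      ∑ v, ∑ w, ∑ k ∈ Finset.range (n - 1),
        if H.Adj v w ∧ (e.symm v : ℕ) ≤ k ∧ k < e.symm w then (y (k + 1) - y k) ^ 2 else 0 := by
    rw [Finset.sum_congr rfl fun v _ ↦ Finset.sum_comm, Finset.sum_comm]
    refine Finset.sum_le_sum fun k hk ↦ ?_
    have hk' : k + 1 < n := by have := Finset.mem_range.1 hk; omega
    obtain ⟨v, hv, w, hw, hvw⟩ := exists_adj_of_algConn_pos hV hH {v | (e.symm v : ℕ) ≤ k}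
      (a := e ⟨0, by omega⟩) (b := e ⟨k + 1, hk'⟩) (by simp) (by simp)
    have hw : k < e.symm w := not_le.1 hw
    have hnn : ∀ v w, 0 ≤ if H.Adj v w ∧ (e.symm v : ℕ) ≤ k ∧ k < e.symm w then
        (y (k + 1) - y k) ^ 2 else 0 := fun v w ↦ by positivity
    refine le_trans ?_ (Finset.single_le_sum
      (fun v _ ↦ Finset.sum_nonneg fun w _ ↦ hnn v w) (Finset.mem_univ v))
    refine le_trans ?_ (Finset.single_le_sum (fun w _ ↦ hnn v w) (Finset.mem_univ w))
    rw [if_pos ⟨hvw, hv, hw⟩]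
  refine hdir.trans ?_
  have hterm : ∀ v w, (∑ k ∈ Finset.range (n - 1),
      if H.Adj v w ∧ (e.symm v : ℕ) ≤ k ∧ k < e.symm w then (y (k + 1) - y k) ^ 2 else 0) ≤
      if H.Adj v w ∧ e.symm v < e.symm w then (x v - x w) ^ 2 else 0 := by
    intro v w
    by_cases h : H.Adj v w ∧ e.symm v < e.symm w
    · rw [if_pos h, ← Finset.sum_filter]
      have hfil : (Finset.range (n - 1)).filter
          (fun k ↦ H.Adj v w ∧ (e.symm v : ℕ) ≤ k ∧ k < e.symm w) =
          Finset.Ico (e.symm v : ℕ) (e.symm w) := by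
        ext k
        have := (e.symm w).2
        simp only [Finset.mem_filter, Finset.mem_range, Finset.mem_Ico, h.1, true_and]
        omega
      rw [hfil, ← hye v, ← hye w, ← neg_sq (y (e.symm v) - _), neg_sub]
      exact (sum_sq_sub_le_sq_sub (Fin.lt_def.1 h.2).le fun k _ hk ↦
        hystep k (by have := (e.symm w).2; omega)).1
    · rw [if_neg h]
      refine (Finset.sum_eq_zero fun k _ ↦ if_neg fun h' ↦ h ⟨h'.1, ?_⟩).le
      exact Fin.lt_def.2 (by omega)
  refine (Finset.sum_le_sum fun v _ ↦ Finset.sum_le_sum fun w _ ↦ hterm v w).trans ?_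
  -- Exactly one orientation of an edge increases in the sorted order, which absorbs the factor `1 /
  -- 2` of the Dirichlet form.
  have hsplit : ∀ v w, (if H.Adj v w then (x v - x w) ^ 2 else 0) =
      (if H.Adj v w ∧ e.symm v < e.symm w then (x v - x w) ^ 2 else 0) +
        if H.Adj w v ∧ e.symm w < e.symm v then (x w - x v) ^ 2 else 0 := by
    intro v w
    by_cases h : H.Adj v w
    · rcases lt_or_gt_of_ne fun h' ↦ h.ne (e.symm.injective h') with h' | h'
      · simp [h, h', h'.not_gt]
      · simp [h, h.symm, h', h'.not_gt, sub_sq_comm (x v)]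
    · have h2 : ¬ H.Adj w v := fun h' ↦ h h'.symm
      simp [h, h2]
  unfold dirichletForm
  simp only [hsplit, Finset.sum_add_distrib]
  rw [Finset.sum_comm (f := fun v w ↦ if H.Adj w v ∧ e.symm w < e.symm v then
    (x w - x v) ^ 2 else 0), add_self_div_two]

end Fiedler

/-! ### Fiedler number of a Cartesian product -/

section BoxProd

variable {V W : Type*} [Fintype V] [Fintype W]

theorem dirichletForm_boxProd (H : SimpleGraph V) (K : SimpleGraph W) (x : V × W → ℝ) :
    dirichletForm (H.boxProd K) x =
      ∑ w, dirichletForm H (fun v ↦ x (v, w)) + ∑ v, dirichletForm K fun w ↦ x (v, w) := by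
  classical
  unfold dirichletForm
  rw [← Finset.sum_div, ← Finset.sum_div, ← add_div]
  congr 1
  have h1 : ∀ (v v' : V) (w w' : W),
      (if (H.boxProd K).Adj (v, w) (v', w') then (x (v, w) - x (v', w')) ^ 2 else 0) =
      (if w' = w then (if H.Adj v v' then (x (v, w) - x (v', w')) ^ 2 else 0) else 0) +
        if v' = v then (if K.Adj w w' then (x (v, w) - x (v', w')) ^ 2 else 0) else 0 := by
    intro v v' w w'
    rw [SimpleGraph.boxProd_adj]
    by_cases hv : v' = v
    · subst hv
      simp
    · by_cases hw : w' = w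
      · subst hw
        simp [hv]
      · simp [hv, hw, Ne.symm hv, Ne.symm hw]
  simp only [Fintype.sum_prod_type, h1, Finset.sum_add_distrib, Finset.sum_ite_eq',
    Finset.mem_univ, if_true]
  congr 1
  · rw [Finset.sum_comm]
  · refine Finset.sum_congr rfl fun v _ ↦ Finset.sum_congr rfl fun w _ ↦ ?_
    rw [Finset.sum_comm]
    simp

/-- The variance of a function on a product is at most the sum of its conditional variances. -/
theorem sum_sq_le_sum_sq_sub_mean [Nonempty V] [Nonempty W] (x : V × W → ℝ)
    (hx : ∑ a, x a = 0) :
    ∑ a, x a ^ 2 ≤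
      ∑ w, ∑ v, (x (v, w) - (∑ v', x (v', w)) / Fintype.card V) ^ 2 +
        ∑ v, ∑ w, (x (v, w) - (∑ w', x (v, w')) / Fintype.card W) ^ 2 := by
  set n : ℝ := ((Fintype.card V : ℕ) : ℝ) with hn
  set m : ℝ := ((Fintype.card W : ℕ) : ℝ) with hm
  have hn0 : n ≠ 0 := by positivity
  have hm0 : m ≠ 0 := by positivity
  set r : W → ℝ := fun w ↦ (∑ v', x (v', w)) / n with hr
  set s : V → ℝ := fun v ↦ (∑ w', x (v, w')) / m with hs
  have hrsum : ∑ w, r w = 0 := by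
    simp only [hr]
    rw [← Finset.sum_div, ← Fintype.sum_prod_type_right, hx, zero_div]
  have hxr : ∀ w, ∑ v, x (v, w) = n * r w := fun w ↦ by simp only [hr]; field_simp
  have hxs : ∀ v, ∑ w, x (v, w) = m * s v := fun v ↦ by simp only [hs]; field_simp
  -- The gap in the inequality is exactly this sum: the cross term `∑ r w * s v` vanishes because
  -- `r` sums to zero.
  have key : 0 ≤ ∑ v, ∑ w, (x (v, w) - r w - s v) ^ 2 :=
    Finset.sum_nonneg fun v _ ↦ Finset.sum_nonneg fun w _ ↦ sq_nonneg _
  have hrs : ∑ v, ∑ w, r w * s v = 0 := by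
    simp only [← Finset.sum_mul, hrsum, zero_mul, Finset.sum_const_zero]
  rw [Fintype.sum_prod_type, Finset.sum_comm (s := (Finset.univ : Finset W))]
  have hident : ∑ v, ∑ w, (x (v, w) - r w) ^ 2 + ∑ v, ∑ w, (x (v, w) - s v) ^ 2 =
      ∑ v, ∑ w, x (v, w) ^ 2 + ∑ v, ∑ w, (x (v, w) - r w - s v) ^ 2 - 2 * ∑ v, ∑ w, r w * s v := by
    simp only [Finset.mul_sum, ← Finset.sum_add_distrib, ← Finset.sum_sub_distrib]
    exact Finset.sum_congr rfl fun v _ ↦ Finset.sum_congr rfl fun w _ ↦ by ring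
  rw [hident, hrs]
  linarith

theorem algConn_mul_sum_sq_sub_mean_le (hV : 2 ≤ Fintype.card V) (H : SimpleGraph V) (x : V → ℝ) :
    algConn H * ∑ v, (x v - (∑ v', x v') / Fintype.card V) ^ 2 ≤ dirichletForm H x := by
  rw [← dirichletForm_sub_const H x ((∑ v', x v') / Fintype.card V)]
  refine (le_algConn_iff hV H _).1 le_rfl _ ?_
  have hcard : (Fintype.card V : ℝ) ≠ 0 := by
    have : 0 < Fintype.card V := by omega
    positivity
  rw [Finset.sum_sub_distrib, Finset.sum_const, Finset.card_univ, nsmul_eq_mul,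
    mul_div_cancel₀ _ hcard, sub_self]

/-- The upper bound tests functions pulled back from one factor. The lower bound applies the
Poincaré inequality on each fibre and adds up the conditional variances. -/
theorem algConn_boxProd (hV : 2 ≤ Fintype.card V) (hW : 2 ≤ Fintype.card W)
    (H : SimpleGraph V) (K : SimpleGraph W) :
    algConn (H.boxProd K) = min (algConn H) (algConn K) := by
  have hVW : 2 ≤ Fintype.card (V × W) := by rw [Fintype.card_prod]; nlinarith
  have : Nonempty V := Fintype.card_pos_iff.1 (by omega)
  have : Nonempty W := Fintype.card_pos_iff.1 (by omega)
  refine le_antisymm (le_min ?_ ?_) ?_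
  · refine (le_algConn_iff hV H _).2 fun y hy ↦ ?_
    have h := (le_algConn_iff hVW (H.boxProd K) _).1 le_rfl (fun a ↦ y a.1)
      (by rw [Fintype.sum_prod_type_right]; simp [hy])
    rw [dirichletForm_boxProd, Fintype.sum_prod_type_right] at h
    simp only [Finset.sum_const, Finset.card_univ, nsmul_eq_mul] at h
    rw [Finset.sum_eq_zero fun v _ ↦ dirichletForm_eq_zero K fun _ _ _ ↦ rfl, add_zero,
      mul_left_comm] at h
    exact le_of_mul_le_mul_left h (by exact_mod_cast Fintype.card_pos)
  · refine (le_algConn_iff hW K _).2 fun y hy ↦ ?_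
    have h := (le_algConn_iff hVW (H.boxProd K) _).1 le_rfl (fun a ↦ y a.2)
      (by rw [Fintype.sum_prod_type]; simp [hy])
    rw [dirichletForm_boxProd, Fintype.sum_prod_type] at h
    simp only [Finset.sum_const, Finset.card_univ, nsmul_eq_mul] at h
    rw [Finset.sum_eq_zero fun w _ ↦ dirichletForm_eq_zero H fun _ _ _ ↦ rfl, zero_add,
      mul_left_comm] at h
    exact le_of_mul_le_mul_left h (by exact_mod_cast Fintype.card_pos)
  · refine (le_algConn_iff hVW _ _).2 fun x hx ↦ ?_
    have hnn : 0 ≤ min (algConn H) (algConn K) :=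
      le_min (algConn_nonneg hV H) (algConn_nonneg hW K)
    refine (mul_le_mul_of_nonneg_left (sum_sq_le_sum_sq_sub_mean x hx) hnn).trans ?_
    rw [dirichletForm_boxProd, mul_add, Finset.mul_sum, Finset.mul_sum]
    refine add_le_add (Finset.sum_le_sum fun w _ ↦ ?_) (Finset.sum_le_sum fun v _ ↦ ?_)
    · exact (mul_le_mul_of_nonneg_right (min_le_left _ _)
        (Finset.sum_nonneg fun _ _ ↦ sq_nonneg _)).trans (algConn_mul_sum_sq_sub_mean_le hV H _)
    · exact (mul_le_mul_of_nonneg_right (min_le_right _ _)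
        (Finset.sum_nonneg fun _ _ ↦ sq_nonneg _)).trans (algConn_mul_sum_sq_sub_mean_le hW K _)

end BoxProd


/-! ### Generic perturbations and the four claims -/

open Filter Topology

theorem eventually_add_mul_ne_zero (a : ℝ) {b : ℝ} (hb : b ≠ 0) :
    ∀ᶠ ε in 𝓝[>] (0 : ℝ), a + ε * b ≠ 0 := by
  have h : ∀ᶠ ε in 𝓝[>] (0 : ℝ), ε ≠ -a / b := by
    rcases le_or_gt (-a / b) 0 with hc | hc
    · filter_upwards [self_mem_nhdsWithin] with ε hε
      exact (hc.trans_lt hε).ne'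
    · filter_upwards [Ioo_mem_nhdsGT hc] with ε hε
      exact hε.2.ne
  filter_upwards [h] with ε hε h0
  exact hε (by rw [eq_div_iff hb]; linarith)

section Generic

variable {V : Type*} [Fintype V]

/-- Small generic perturbations of a configuration are frameworks of `ℓ_∞^d`. -/
theorem exists_eventually_mem_frameworks (G : SimpleGraph V) {d : ℕ} (hd : d ≠ 0)
    (q : V → Fin d → ℝ) :
    ∃ r : V → Fin d → ℝ, ∀ᶠ ε in 𝓝[>] (0 : ℝ), q + ε • r ∈ frameworks G (Fin d → ℝ) := by
  have : Nonempty (Fin d) := Fin.pos_iff_nonempty.1 (Nat.pos_of_ne_zero hd)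
  let N : V → ℝ := fun v ↦ ((Fintype.equivFin V v : ℕ) : ℝ)
  have hN : Function.Injective N := fun v w h ↦
    (Fintype.equivFin V).injective (Fin.ext (Nat.cast_injective h))
  -- Along this direction, for distinct vertices, the coordinates of a difference move at non-zero
  -- speeds of pairwise distinct moduli. So no coordinate, and no sum or difference of two distinct
  -- coordinates, vanishes for small `ε > 0`; this excludes ties in modulus.
  refine ⟨fun v i ↦ N v * (i + 1), ?_⟩
  have h1 : ∀ᶠ ε in 𝓝[>] (0 : ℝ), ∀ v w : V, v ≠ w → ∀ i : Fin d,
      (q v i - q w i) + ε * ((N v - N w) * (i + 1)) ≠ 0 := by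
    refine eventually_all.2 fun v ↦ eventually_all.2 fun w ↦ ?_
    by_cases hvw : v = w
    · exact Eventually.of_forall fun ε h ↦ absurd hvw h
    refine (eventually_all.2 fun i ↦ eventually_add_mul_ne_zero _
      (mul_ne_zero (sub_ne_zero.2 (hN.ne hvw)) (by positivity))).mono fun ε h _ ↦ h
  have h2 : ∀ᶠ ε in 𝓝[>] (0 : ℝ), ∀ v w : V, v ≠ w → ∀ i j : Fin d, i ≠ j →
      (q v i - q w i) - (q v j - q w j) + ε * ((N v - N w) * ((i : ℝ) - j)) ≠ 0 := by
    refine eventually_all.2 fun v ↦ eventually_all.2 fun w ↦ ?_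
    by_cases hvw : v = w
    · exact Eventually.of_forall fun ε h ↦ absurd hvw h
    refine (eventually_all.2 fun i ↦ eventually_all.2 fun j ↦ ?_).mono fun ε h _ ↦ h
    by_cases hij : i = j
    · exact Eventually.of_forall fun ε h ↦ absurd hij h
    refine (eventually_add_mul_ne_zero _ (mul_ne_zero (sub_ne_zero.2 (hN.ne hvw))
      (sub_ne_zero.2 fun h ↦ hij (Fin.ext (Nat.cast_injective h))))).mono fun ε h _ ↦ h
  have h3 : ∀ᶠ ε in 𝓝[>] (0 : ℝ), ∀ v w : V, v ≠ w → ∀ i j : Fin d,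
      (q v i - q w i) + (q v j - q w j) + ε * ((N v - N w) * ((i : ℝ) + j + 2)) ≠ 0 := by
    refine eventually_all.2 fun v ↦ eventually_all.2 fun w ↦ ?_
    by_cases hvw : v = w
    · exact Eventually.of_forall fun ε h ↦ absurd hvw h
    refine (eventually_all.2 fun i ↦ eventually_all.2 fun j ↦ eventually_add_mul_ne_zero _
      (mul_ne_zero (sub_ne_zero.2 (hN.ne hvw)) (by positivity))).mono fun ε h _ ↦ h
  filter_upwards [h1, h2, h3] with ε h1 h2 h3
  refine (mem_frameworks_pi_iff G _).2 fun v w hvw ↦ ⟨fun heq ↦ ?_, ?_⟩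
  · obtain ⟨i⟩ := ‹Nonempty (Fin d)›
    have := congrFun heq i
    simp only [Pi.add_apply, Pi.smul_apply, smul_eq_mul] at this
    exact h1 v w hvw.ne i (by linarith)
  · obtain ⟨i, hi⟩ := exists_norm_eq_abs ((q + ε • fun v (i : Fin d) ↦ N v * ((i : ℝ) + 1)) v -
      (q + ε • fun v (i : Fin d) ↦ N v * ((i : ℝ) + 1)) w)
    refine ⟨i, isDominant_of_norm_eq hi fun j hj ↦ ?_⟩
    by_contra hij
    rw [hi] at hj
    simp only [Pi.add_apply, Pi.sub_apply, Pi.smul_apply, smul_eq_mul] at hj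
    rcases abs_eq_abs.1 hj with h | h
    · exact h2 v w hvw.ne i j (Ne.symm hij) (by linarith)
    · exact h3 v w hvw.ne i j (by linarith)

/-- Some framework of `ℓ_∞^d` realises every strict dominance of a given configuration. -/
theorem exists_mem_frameworks_isDominant (G : SimpleGraph V) {d : ℕ} (hd : d ≠ 0)
    (q : V → Fin d → ℝ) :
    ∃ p ∈ frameworks G (Fin d → ℝ),
      ∀ v w i, IsDominant (q v - q w) i → IsDominant (p v - p w) i := by
  obtain ⟨r, hr⟩ := exists_eventually_mem_frameworks G hd q
  have hdom : ∀ᶠ ε in 𝓝[>] (0 : ℝ), ∀ v w i, IsDominant (q v - q w) i →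
      IsDominant ((q + ε • r) v - (q + ε • r) w) i := by
    refine eventually_all.2 fun v ↦ eventually_all.2 fun w ↦ eventually_all.2 fun i ↦ ?_
    by_cases h : IsDominant (q v - q w) i
    · have hcont : Continuous fun ε : ℝ ↦ (q + ε • r) v - (q + ε • r) w := by
        simp only [Pi.add_apply, Pi.smul_apply]
        fun_prop
      have ht := hcont.tendsto 0
      rw [zero_smul, add_zero] at ht
      exact ((ht.mono_left nhdsWithin_le_nhds).eventually h.eventually).mono fun ε h _ ↦ h
    · exact Eventually.of_forall fun ε h' ↦ absurd h' h
  obtain ⟨ε, h1, h2⟩ := (hr.and hdom).exists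
  exact ⟨_, h1, h2⟩

theorem frameworks_pi_nonempty (G : SimpleGraph V) {d : ℕ} (hd : d ≠ 0) :
    (frameworks G (Fin d → ℝ)).Nonempty := by
  obtain ⟨p, hp, _⟩ := exists_mem_frameworks_isDominant G hd 0
  exact ⟨p, hp⟩

/-- Dominance among all coordinates persists after dropping the last one. The projection may have
ties on edges of the lost colour, and the perturbation recolours these without disturbing strict
dominance elsewhere. -/
theorem exists_monochrome_castSucc_le (G : SimpleGraph V) {d : ℕ} (hd : d ≠ 0)
    {p : V → Fin (d + 1) → ℝ} (hp : p ∈ frameworks G (Fin (d + 1) → ℝ)) :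
    ∃ q ∈ frameworks G (Fin d → ℝ), ∀ i : Fin d,
      monochrome G p i.castSucc ≤ monochrome G q i := by
  obtain ⟨q, hq, hdom⟩ := exists_mem_frameworks_isDominant G hd fun v i ↦ p v i.castSucc
  refine ⟨q, hq, fun i v w h ↦ ?_⟩
  rw [monochrome_adj_iff hp] at h
  exact (monochrome_adj_iff hq).2 ⟨h.1, hdom v w i fun j hj ↦
    h.2 j.castSucc fun h' ↦ hj (Fin.castSucc_injective d h')⟩

/-- The eigenvalue depends only on the decomposition, a tuple of graphs on a finite vertex set. -/
theorem finite_rigidityEigenvalue_image (hV : 2 ≤ Fintype.card V) (G : SimpleGraph V) {d : ℕ}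
    (hd : d ≠ 0) :
    (rigidityEigenvalue G (Pi.basisFun ℝ (Fin d)) '' frameworks G (Fin d → ℝ)).Finite := by
  refine (Set.finite_range fun H : Fin d → SimpleGraph V ↦ ⨅ i, algConn (H i)).subset ?_
  rintro _ ⟨p, hp, rfl⟩
  exact ⟨monochrome G p, (rigidityEigenvalue_eq hV G hd hp).symm⟩

theorem isGreatest_algConnLInfty (hV : 2 ≤ Fintype.card V) (G : SimpleGraph V) {d : ℕ}
    (hd : d ≠ 0) :
    IsGreatest (rigidityEigenvalue G (Pi.basisFun ℝ (Fin d)) '' frameworks G (Fin d → ℝ))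
      (algConnLInfty G d) :=
  ⟨((frameworks_pi_nonempty G hd).image _).csSup_mem (finite_rigidityEigenvalue_image hV G hd),
    fun _ hx ↦ le_csSup (finite_rigidityEigenvalue_image hV G hd).bddAbove hx⟩

theorem algConnLInfty_succ_le (hV : 2 ≤ Fintype.card V) (G : SimpleGraph V) {d : ℕ}
    (hd : d ≠ 0) : algConnLInfty G (d + 1) ≤ algConnLInfty G d := by
  have : Nonempty (Fin d) := Fin.pos_iff_nonempty.1 (Nat.pos_of_ne_zero hd)
  obtain ⟨p, hp, hpa⟩ := (isGreatest_algConnLInfty hV G d.succ_ne_zero).1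
  obtain ⟨q, hq, hle⟩ := exists_monochrome_castSucc_le G hd hp
  rw [← hpa]
  refine le_trans ?_ ((isGreatest_algConnLInfty hV G hd).2 ⟨q, hq, rfl⟩)
  exact (le_rigidityEigenvalue_iff hV G hd hq _).2 fun i ↦
    ((le_rigidityEigenvalue_iff hV G d.succ_ne_zero hp _).1 le_rfl i.castSucc).trans
      (algConn_mono hV (hle i))

/-- At an optimal framework each of the `d` edge-disjoint colour classes has Fiedler number at least
`algConnLInfty G d`, and their sum is at most `algConn G`. -/
theorem algConnLInfty_le_div (hV : 2 ≤ Fintype.card V) (G : SimpleGraph V) {d : ℕ}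
    (hd : d ≠ 0) : algConnLInfty G d ≤ algConn G / d := by
  obtain ⟨p, hp, hpa⟩ := (isGreatest_algConnLInfty hV G hd).1
  have hle := (le_rigidityEigenvalue_iff hV G hd hp _).1 hpa.ge
  rw [le_div_iff₀ (by positivity), mul_comm]
  calc (d : ℝ) * algConnLInfty G d = ∑ _i : Fin d, algConnLInfty G d := by simp
    _ ≤ ∑ i, algConn (monochrome G p i) := Finset.sum_le_sum fun i _ ↦ hle i
    _ ≤ algConn G := sum_algConn_le hV G _ (fun i v w h ↦ h.1) fun i j v w hi hj ↦
        ((monochrome_adj_iff hp).1 hi).2.eq ((monochrome_adj_iff hp).1 hj).2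

theorem algConnLInfty_eq_zero_or_le (hV : 2 ≤ Fintype.card V) (G : SimpleGraph V) {d : ℕ}
    (hd : d ≠ 0) :
    algConnLInfty G d = 0 ∨
      2 * (1 - Real.cos (Real.pi / (Fintype.card V : ℝ))) ≤ algConnLInfty G d := by
  obtain ⟨p, hp, hpa⟩ := (isGreatest_algConnLInfty hV G hd).1
  have hiff := le_rigidityEigenvalue_iff hV G hd hp
  rw [hpa] at hiff
  have h0 : 0 ≤ algConnLInfty G d := (hiff 0).2 fun i ↦ algConn_nonneg hV _
  refine h0.eq_or_lt.imp Eq.symm fun hpos ↦ (hiff _).2 fun i ↦ le_algConn_of_pos hV ?_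
  exact hpos.trans_le ((hiff _).1 le_rfl i)

theorem image_algConn_boxProd_monochromeDecompositions (hV : 2 ≤ Fintype.card V)
    (G : SimpleGraph V) :
    (fun H : Fin 2 → SimpleGraph V ↦ algConn (SimpleGraph.boxProd (H 0) (H 1))) ''
        monochromeDecompositions G 2 =
      rigidityEigenvalue G (Pi.basisFun ℝ (Fin 2)) '' frameworks G (Fin 2 → ℝ) := by
  have hdec : monochromeDecompositions G 2 = monochrome G '' frameworks G (Fin 2 → ℝ) := by
    ext H
    exact exists_congr fun p ↦ and_congr_right fun _ ↦ eq_comm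
  rw [hdec, Set.image_image]
  refine Set.image_congr fun p hp ↦ eq_of_forall_le_iff fun c ↦ ?_
  rw [algConn_boxProd hV hV, le_rigidityEigenvalue_iff hV G two_ne_zero hp, le_min_iff,
    Fin.forall_fin_two]

end Generic

end NormedRigidity

theorem corollaryc {V : Type*} [Fintype V] (G : SimpleGraph V) (d : ℕ) (hd : 2 ≤ d)
    (hn : d + 1 ≤ Fintype.card V) :
    NormedRigidity.algConnLInfty G d ≤ NormedRigidity.algConnLInfty G (d - 1) ∧
    NormedRigidity.algConnLInfty G d ≤ NormedRigidity.algConn G / (d : ℝ) ∧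
    (NormedRigidity.algConnLInfty G d = 0 ∨
      2 * (1 - Real.cos (Real.pi / (Fintype.card V : ℝ))) ≤ NormedRigidity.algConnLInfty G d) ∧
    IsGreatest
      ((fun H : Fin 2 → SimpleGraph V ↦
          NormedRigidity.algConn (SimpleGraph.boxProd (H 0) (H 1))) ''
        NormedRigidity.monochromeDecompositions G 2)
      (NormedRigidity.algConnLInfty G 2) := by
  have hV : 2 ≤ Fintype.card V := by omega
  have hd0 : d ≠ 0 := by omega
  refine ⟨?_, NormedRigidity.algConnLInfty_le_div hV G hd0,
    NormedRigidity.algConnLInfty_eq_zero_or_le hV G hd0, ?_⟩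
  · obtain ⟨m, rfl⟩ : ∃ m, d = m + 1 := ⟨d - 1, by omega⟩
    exact NormedRigidity.algConnLInfty_succ_le hV G (by omega)
  · rw [NormedRigidity.image_algConn_boxProd_monochromeDecompositions hV G]
    exact NormedRigidity.isGreatest_algConnLInfty hV G two_ne_zero
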